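/- **Setting.** Let $\triangle$ be a simplicial complex with finitely many 4-simplices $\nu$, each oriented by a positively oriented numbering $1,\dots,5$ of its vertices. Let $l_P$ be the oriented line from the barycenter $C_\nu$ to the barycenter of the 3-simplex opposite to the vertex $P$; the oriented wedges $s_{PQ}$ of $\nu$ correspond to ordered pairs $(l_P,l_Q)$, $P\ne Q$; the corner cell $c_T$ of the vertex $T$ contains the lines $l_P$ and the wedges $s_{PQ}$ with $P,Q\ne T$. For a wedge $s=(l_1,l_2)$ dual to the 2-simplex $\sigma$, where $l_i$ ends in $\tau_i$, let $r_i$ be the line from the barycenter of $\tau_i$ to that of $\sigma$. Put $\mathrm{sgn}(s_{PQ},s_{RS})=\mathrm{sgn}(l_P,l_Q,s_{RS})=\sum_T\epsilon^{PQRST}$; wedges $s,s'$ are transversal if $\mathrm{sgn}(s,s')\neq0$. Let $\eta=\mathrm{diag}(-1,1,1,1)$ and $\epsilon^{0123}=1$ (so $\epsilon_{0123}=-1$). Let $(T_i)$ be a basis of $so(3,1)$ and $(T^i)$ the dual basis, $\mathrm{tr}(T^iT_j)=\delta^i_j$; write $X=X_iT^i=X^iT_i$ for $X\in so(3,1)$,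 $X^{IJ}=X^I{}_K\eta^{KJ}$, $f_{ijk}=\mathrm{tr}([T_i,T_j]T_k)$, $(\ast X)^{IJ}=\tfrac12\epsilon^{IJ}{}_{KL}X^{KL}$, $(u\wedge v)^{IJ}=u^Iv^J-u^Jv^I$. Let $\gamma\in(\mathbb R\setminus\{0\})\cup\{\infty\}$. Fields: a connection $(h,k)$, with $h_l\in SO(3,1)$ for each line $l<\nu$ and $k_r\in SO(3,1)$ for each line $r$ from the barycenter of a 3-simplex $\tau$ of a 4-simplex to that of a 2-simplex of $\tau$; a tetrad field $e$, $e_l\in\mathbb R^{3,1}$; a $B$ field, $B_s\in so(3,1)$ for each oriented wedge, with $B_{\bar s}=-B_s$ for the opposite orientation $\bar s$. Put $\theta^i_s=\mathrm{tr}[T^ih_{l_2}^{-1}k_{r_2}^{-1}k_{r_1}h_{l_1}]$ and $P_{IJKL}=\epsilon_{IJKL}-\frac1{2\gamma}\epsilon_{IJMN}\epsilon^{MN}{}_{KL}$. The actions of the $e$-model and of the $B$-model are (each orientation of a wedge is counted) $$S(e,h,k)=\sum_\nu\sum_{l,l',s<\nu}\mathrm{sgn}(l,l',s)\,e_l^Ke_{l'}^L(T_i)^{JI}P_{IJKL}\,\theta^i_s,\qquad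 S(B,h,k)=\sum_\nu\sum_{s,s'<\nu}\mathrm{sgn}(s,s')\Big(B_{si}-\frac1\gamma{\ast}B_{si}\Big)\theta^i_{s'} .$$ At a corner cell $c$ let $\Sigma(c)=\sum\mathrm{sgn}(s,s')\epsilon_{IJKL}B_s^{IJ}B_{s'}^{KL}$, the sum over the 12 unordered pairs of transversal oriented wedges of $c$, and $V(c)=4^4\,\Sigma(c)/12$. The conditions, imposed at every corner cell, are: * GG1: $\epsilon_{IJKL}B_s^{IJ}B_{s'}^{KL}-\frac1{12}\mathrm{sgn}(s,s')\Sigma(c)=0$ for all $s,s'<c$ (then $V(c)=4^4\,\mathrm{sgn}(s,s')\epsilon_{IJKL}B_s^{IJ}B_{s'}^{KL}$ for each transversal pair); * GG2: $V(c)>0$; * GG3: the form $g_{QR}(c_P)=\frac1{12V(c_P)}f_{ijk}\epsilon^{ABCDP}B^i_{QA}B^j_{BC}B^k_{DR}$ on the four lines of $c_P$ has the signature of $\eta$. $B$-model 2 is the action $S(B,h,k)$ with the $B$ field constrained by GG1. A tetrad field is *nondegenerate* if at every corner cell its four vectors form a basis, and *positively oriented* at $c_T$ if $\det(e_P,e_Q,e_R,e_S)>0$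 whenever $\epsilon^{PQRST}=1$. A sector $E$ of the $e$-model is called *equivalent* to the $B$-model with a constraint set $C$ if the map $e\mapsto B$, $B_{PQ}=\ast(e_P\wedge e_Q)$, has image $C$ on $E$; two fields $e,e'\in E$ have the same image if and only if $e'=\pm e$ on each 4-simplex, the sign depending on the 4-simplex; $S(B,h,k)=S(e,h,k)$ for all $e\in E$ and all $(h,k)$; and $(B,h,k)$ is stationary for $S$ under all smooth variations within $C$ with $k$ fixed on the boundary if and only if $(e,h,k)$ is stationary under all smooth variations within $E$ with $k$ fixed on the boundary. **Statement.** 1. $B$-model 2, complemented with GG2 and GG3, is equivalent to the $e$-model in its nondegenerate, positively oriented sector. 2. $B$-model 2, complemented with $V(c)\neq0$ at all corner cells and GG3, is equivalent to the $e$-model in its whole nondegenerate sector. 3. For a nondegenerate $e$ and every corner cell $c$, the field $B_{PQ}=\ast(e_P\wedge e_Q)$ satisfies GG2 at $c$ if and only if $e$ is positively oriented at $c$. -/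

import Mathlib

open scoped Matrix ContDiff Topology
open Filter

noncomputable section

namespace SimplicialGravity

/-! ## Minkowski space, `SO(3,1)`, `so(3,1)` -/

/-- The Minkowski metric `diag(-1, 1, 1, 1)`; index `0` is the time index. -/
def η : Matrix (Fin 4) (Fin 4) ℝ := Matrix.diagonal ![-1, 1, 1, 1]

/-- The copy of Minkowski space attached to the barycenter of a simplex. -/
abbrev Mink := Fin 4 → ℝ

/-- The Levi-Civita symbol: the sign of `i` if `i` is a permutation of `Fin n`, and `0` if an
index is repeated. -/
def levi {n : ℕ} (i : Fin n → Fin n) : ℤ :=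
  ∏ a : Fin n, ∏ b ∈ Finset.Ioi a, Int.sign (((i b : ℕ) : ℤ) - ((i a : ℕ) : ℤ))

/-- The Levi-Civita tensor `ε_{IJKL}` of Minkowski space, normalised by `ε^{0123} = 1`, that is,
`ε_{0123} = -1`. -/
def eps (I J K L : Fin 4) : ℝ := -(levi ![I, J, K, L] : ℝ)

/-- `ε^{IJ}_{KL}`: the first two indices of `ε_{IJKL}` are raised with `η` (which is diagonal and
equal to its inverse). -/
def epsUp (I J K L : Fin 4) : ℝ := η I I * η J J * eps I J K L

/-- The group `SO(3,1)` of real matrices of determinant one that preserve `η`. -/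
def SO31 : Subgroup (Matrix.SpecialLinearGroup (Fin 4) ℝ) where
  carrier := {g | (g : Matrix (Fin 4) (Fin 4) ℝ)ᵀ * η * (g : Matrix (Fin 4) (Fin 4) ℝ) = η}
  one_mem' := by simp
  mul_mem' := by
    intro a b ha hb
    simp only [Set.mem_ofPred_eq] at ha hb ⊢
    rw [Matrix.SpecialLinearGroup.coe_mul, Matrix.transpose_mul]
    calc _ = (b : Matrix (Fin 4) (Fin 4) ℝ)ᵀ *
          ((a : Matrix (Fin 4) (Fin 4) ℝ)ᵀ * η * (a : Matrix (Fin 4) (Fin 4) ℝ)) *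
          (b : Matrix (Fin 4) (Fin 4) ℝ) := by simp only [Matrix.mul_assoc]
      _ = η := by rw [ha, hb]
  inv_mem' := by
    intro a ha
    simp only [Set.mem_ofPred_eq] at ha ⊢
    have h1 : (a : Matrix (Fin 4) (Fin 4) ℝ) *
        ((a⁻¹ : Matrix.SpecialLinearGroup (Fin 4) ℝ) : Matrix (Fin 4) (Fin 4) ℝ) = 1 := by
      rw [← Matrix.SpecialLinearGroup.coe_mul, mul_inv_cancel, Matrix.SpecialLinearGroup.coe_one]
    set A := (a : Matrix (Fin 4) (Fin 4) ℝ)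
    set A' := ((a⁻¹ : Matrix.SpecialLinearGroup (Fin 4) ℝ) : Matrix (Fin 4) (Fin 4) ℝ)
    calc A'ᵀ * η * A' = A'ᵀ * (Aᵀ * η * A) * A' := by rw [ha]
      _ = (A * A')ᵀ * η * (A * A') := by
        rw [Matrix.transpose_mul]; simp only [Matrix.mul_assoc]
      _ = η := by rw [h1]; simp

/-- The matrix `g^I_J` of an element of `SO(3,1)`. -/
def soMat (g : SO31) : Matrix (Fin 4) (Fin 4) ℝ := (g : Matrix.SpecialLinearGroup (Fin 4) ℝ)

/-- The commutator bracket of matrices. -/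
instance : LieRing (Matrix (Fin 4) (Fin 4) ℝ) := LieRing.ofAssociativeRing

/-- The Lie algebra `so(3,1)`: matrices `X^I_J` with `Xᵀ η = - η X`. -/
abbrev so31 : LieSubalgebra ℝ (Matrix (Fin 4) (Fin 4) ℝ) := skewAdjointMatricesLieSubalgebra η

theorem mem_so31 (X : Matrix (Fin 4) (Fin 4) ℝ) : X ∈ so31 ↔ Xᵀ * η = η * -X := by
  rw [mem_skewAdjointMatricesLieSubalgebra, mem_skewAdjointMatricesSubmodule]
  rfl

theorem η_mul_η : η * η = 1 := by
  rw [η, Matrix.diagonal_mul_diagonal, ← Matrix.diagonal_one]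
  congr 1
  funext i
  fin_cases i <;> simp

theorem η_transpose : ηᵀ = η := Matrix.diagonal_transpose _

/-- The components `X^{IJ}` of an element `X^I_J` of `so(3,1)`, with both indices upstairs. -/
def bivec (X : so31) : Matrix (Fin 4) (Fin 4) ℝ := (X : Matrix (Fin 4) (Fin 4) ℝ) * η

/-- The element `N^{IK} η_{KJ}` of `so(3,1)` given by an antisymmetric tensor `N^{IJ}`. -/
def ofBivec (N : Matrix (Fin 4) (Fin 4) ℝ) (hN : Nᵀ = -N) : so31 :=
  ⟨N * η, by
    rw [mem_so31, Matrix.transpose_mul, hN, η_transpose]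
    simp [Matrix.mul_assoc]⟩

theorem bivec_transpose (X : so31) : (bivec X)ᵀ = -bivec X := by
  have h := (mem_so31 _).1 X.2
  have h2 : η * ((X : Matrix (Fin 4) (Fin 4) ℝ)ᵀ * η) * η =
      η * (η * -(X : Matrix (Fin 4) (Fin 4) ℝ)) * η := by rw [h]
  have h3 : η * (X : Matrix (Fin 4) (Fin 4) ℝ)ᵀ * (η * η) =
      (η * η) * -(X : Matrix (Fin 4) (Fin 4) ℝ) * η := by
    simpa only [Matrix.mul_assoc] using h2
  rw [η_mul_η, Matrix.mul_one, Matrix.one_mul] at h3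
  rw [bivec, Matrix.transpose_mul, η_transpose, h3, Matrix.neg_mul]

/-- The wedge product `(u ∧ v)^{IJ} = u^I v^J - u^J v^I` of two Minkowski vectors, as an element
of `so(3,1)`. -/
def wedge (u v : Mink) : so31 :=
  ofBivec (Matrix.of fun I J => u I * v J - u J * v I) (by
    ext I J; simp only [Matrix.transpose_apply, Matrix.of_apply, Matrix.neg_apply]; ring)

theorem epsUp_swap (I J K L : Fin 4) : epsUp J I K L = -epsUp I J K L := by
  have h : levi ![J, I, K, L] = -levi ![I, J, K, L] := by
    revert I J K L; decide
  simp only [epsUp, eps, h]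
  push_cast
  ring

/-- The Hodge dual `(∗X)^{IJ} = ½ ε^{IJ}_{KL} X^{KL}` on `so(3,1)`. -/
def hodge (X : so31) : so31 :=
  ofBivec (Matrix.of fun I J => (1 / 2 : ℝ) * ∑ K, ∑ L, epsUp I J K L * bivec X K L) (by
    ext I J
    simp only [Matrix.transpose_apply, Matrix.of_apply, Matrix.neg_apply, epsUp_swap I J,
      neg_mul, Finset.sum_neg_distrib, mul_neg])

/-- The invariant form `(X, Y) ↦ tr (X Y)` on `so(3,1)`; it raises and lowers Lie algebra
indices. -/
def traceForm : LinearMap.BilinForm ℝ so31 :=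
  LinearMap.mk₂ ℝ
    (fun X Y => ((X : Matrix (Fin 4) (Fin 4) ℝ) * (Y : Matrix (Fin 4) (Fin 4) ℝ)).trace)
    (by intro a b c; simp [Matrix.add_mul])
    (by intro a b c; simp)
    (by intro a b c; simp [Matrix.mul_add])
    (by intro a b c; simp)

theorem transpose_mem_so31 (X : so31) : (X : Matrix (Fin 4) (Fin 4) ℝ)ᵀ ∈ so31 := by
  have h := bivec_transpose X
  rw [bivec, Matrix.transpose_mul, η_transpose] at h
  rw [mem_so31, Matrix.transpose_transpose, Matrix.mul_neg, h, neg_neg]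

theorem eq_zero_of_trace (X : so31)
    (h : ((X : Matrix (Fin 4) (Fin 4) ℝ) * (X : Matrix (Fin 4) (Fin 4) ℝ)ᵀ).trace = 0) :
    X = 0 := by
  apply Subtype.ext
  have h' : ((X : Matrix (Fin 4) (Fin 4) ℝ) * (X : Matrix (Fin 4) (Fin 4) ℝ)ᴴ).trace = 0 := by
    rwa [Matrix.conjTranspose_eq_transpose_of_trivial]
  simpa using (Matrix.trace_mul_conjTranspose_self_eq_zero_iff.1 h')

theorem traceForm_nondegenerate : traceForm.Nondegenerate := by
  constructor
  · intro X hX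
    exact eq_zero_of_trace X (hX ⟨_, transpose_mem_so31 X⟩)
  · intro X hX
    have h := hX ⟨_, transpose_mem_so31 X⟩
    apply eq_zero_of_trace X
    rw [Matrix.trace_mul_comm]
    exact h

section LieBasis

variable {ι : Type*} [Fintype ι] [DecidableEq ι] (T : Module.Basis ι ℝ so31)

/-- The basis `T^i` of `so(3,1)` dual to the basis `T_i`: `tr (T^i T_j) = δ^i_j`. -/
def upper : Module.Basis ι ℝ so31 := traceForm.dualBasis traceForm_nondegenerate T

/-- The components `X_i` in `X = X_i T^i`. -/
def lowerComp (X : so31) (i : ι) : ℝ := (upper T).repr X i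

/-- The components `X^i` in `X = X^i T_i`. -/
def upperComp (X : so31) (i : ι) : ℝ := T.repr X i

/-- The structure constants `f_{ijk} = f_{ij}^l tr (T_l T_k)`, where `[T_i, T_j] = f_{ij}^l T_l`. -/
def structConst (i j k : ι) : ℝ := ∑ l, T.repr ⁅T i, T j⁆ l * traceForm (T l) (T k)

end LieBasis

/-! ## The discretized spacetime -/

/-- A simplicial complex with finitely many 4-simplices, each of them oriented by means of a
positively oriented numbering of its five vertices.  (Neither coherence of the orientations nor
the manifold property is required.) -/
structure OrientedComplex (V : Type*) where
  complex : PreAbstractSimplicialComplex V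
  finite : {ν : Finset V | ν ∈ complex ∧ ν.card = 5}.Finite
  numbering : ∀ ν : {ν : Finset V // ν ∈ complex ∧ ν.card = 5}, Fin 5 ≃ {v // v ∈ ν.1}

variable {V : Type*}

/-- The 4-simplices `ν` of the complex. -/
def OrientedComplex.Atom (X : OrientedComplex V) : Type _ :=
  {ν : Finset V // ν ∈ X.complex ∧ ν.card = 5}

instance (X : OrientedComplex V) : Fintype X.Atom := X.finite.fintype

/-- The lines `r(τσ)`: pairs of a 2-simplex `σ` and a 3-simplex `τ` with `σ < τ < ν` for some
4-simplex `ν`. -/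
def OrientedComplex.RLine (X : OrientedComplex V) : Type _ :=
  {p : Finset V × Finset V //
    (∃ ν : X.Atom, p.1 ⊆ ν.1) ∧ p.1.card = 4 ∧ p.2 ⊆ p.1 ∧ p.2.card = 3}

/-- The line `r(τσ)` lies in the boundary if `τ` is a face of exactly one 4-simplex. -/
def OrientedComplex.RLine.IsBoundary {X : OrientedComplex V} (r : X.RLine) : Prop :=
  ∃! ν : X.Atom, r.1.1 ⊆ ν.1

/-- The vertex with number `P` of a 4-simplex. -/
def OrientedComplex.vertex (X : OrientedComplex V) (ν : X.Atom) (P : Fin 5) : V :=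
  (X.numbering ν P).1

theorem OrientedComplex.vertex_mem (X : OrientedComplex V) (ν : X.Atom) (P : Fin 5) :
    X.vertex ν P ∈ ν.1 := (X.numbering ν P).2

theorem OrientedComplex.vertex_injective (X : OrientedComplex V) (ν : X.Atom) :
    Function.Injective (X.vertex ν) := fun _ _ h =>
  (X.numbering ν).injective (Subtype.ext h)

/-- The oriented wedges of a 4-simplex: the wedge `s_{PQ}` corresponds to the ordered pair
`(l_P, l_Q)` of lines, where `l_P` joins the barycenter of the 4-simplex to the barycenter of the
3-simplex that is opposite to the vertex `P`. -/
abbrev OWedge := {p : Fin 5 × Fin 5 // p.1 ≠ p.2}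

/-- The same wedge with the opposite orientation. -/
def OWedge.reverse (s : OWedge) : OWedge := ⟨(s.1.2, s.1.1), s.2.symm⟩

/-- The wedge `s` is contained in the corner cell of the vertex `P`. The corner cell contains the
four lines `l_Q` with `Q ≠ P`. -/
def OWedge.InCell (s : OWedge) (P : Fin 5) : Prop := s.1.1 ≠ P ∧ s.1.2 ≠ P

instance (s : OWedge) (P : Fin 5) : Decidable (s.InCell P) :=
  inferInstanceAs (Decidable (_ ∧ _))

/-- The orientation of the ordered four tuple `(l_P, l_Q, l_R, l_S)` of lines of an oriented
4-simplex: `ε^{PQRST}` with `T` the remaining number, and `0` if a line is repeated. -/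
def sgn4 (P Q R S : Fin 5) : ℤ := ∑ T, levi ![P, Q, R, S, T]

/-- `sgn(l, l', s)`. -/
def sgnLLS (P Q : Fin 5) (s : OWedge) : ℤ := sgn4 P Q s.1.1 s.1.2

/-- `sgn(s, s')`; the wedges are transversal if and only if it does not vanish. -/
def sgnSS (s s' : OWedge) : ℤ := sgn4 s.1.1 s.1.2 s'.1.1 s'.1.2

/-- The line `r₁(s)` from the barycenter of the 3-simplex `τ` at the end of the first line of `s`
to the barycenter of the 2-simplex dual to `s`. -/
def OrientedComplex.r₁ [DecidableEq V] (X : OrientedComplex V) (ν : X.Atom) (s : OWedge) : X.RLine :=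
  ⟨(ν.1 \ {X.vertex ν s.1.1}, ν.1 \ {X.vertex ν s.1.1, X.vertex ν s.1.2}),
    ⟨ν, Finset.sdiff_subset⟩, by
      rw [Finset.card_sdiff_of_subset (by simpa using X.vertex_mem ν _), ν.2.2]; simp,
    Finset.sdiff_subset_sdiff subset_rfl (by simp), by
      rw [Finset.card_sdiff_of_subset (by
        intro v hv
        simp only [Finset.mem_insert, Finset.mem_singleton] at hv
        rcases hv with rfl | rfl <;> exact X.vertex_mem ν _), ν.2.2,
        Finset.card_pair (fun h => s.2 (X.vertex_injective ν h))]⟩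

/-- The line `r₂(s)`, which belongs to the second line of `s`. -/
def OrientedComplex.r₂ [DecidableEq V] (X : OrientedComplex V) (ν : X.Atom) (s : OWedge) : X.RLine :=
  X.r₁ ν s.reverse

/-! ## Fields -/

/-- A discrete tetrad field: a Minkowski vector for each line `l` of each 4-simplex. -/
abbrev Tetrad (X : OrientedComplex V) := X.Atom → Fin 5 → Mink

/-- The parallel transports `h_l`. -/
abbrev HField (X : OrientedComplex V) := X.Atom → Fin 5 → SO31

/-- The parallel transports `k_r`. -/
abbrev KField (X : OrientedComplex V) := X.RLine → SO31

/-- A discrete `B` field: an element of `so(3,1)` for each oriented wedge of each 4-simplex, which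
changes sign with the orientation of the wedge. -/
structure BField (X : OrientedComplex V) where
  val : X.Atom → OWedge → so31
  reverse : ∀ ν s, val ν s.reverse = -val ν s

/-- `B_{PQ}`, with the value `0` for `P = Q`. -/
def BField.comp {X : OrientedComplex V} (B : BField X) (ν : X.Atom) (P Q : Fin 5) : so31 :=
  if h : P ≠ Q then B.val ν ⟨(P, Q), h⟩ else 0

theorem wedge_swap (u v : Mink) : wedge v u = -wedge u v := by
  apply Subtype.ext
  ext I J
  simp only [wedge, ofBivec, NegMemClass.coe_neg, Matrix.mul_apply, Matrix.of_apply,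
    Matrix.neg_apply, ← Finset.sum_neg_distrib]
  refine Finset.sum_congr rfl fun K _ => ?_
  ring

theorem hodge_neg (X : so31) : hodge (-X) = -hodge X := by
  apply Subtype.ext
  ext I J
  simp [hodge, ofBivec, bivec, Matrix.mul_apply]

/-- The `B` field `B_{PQ} = ∗(e_P ∧ e_Q)` of a tetrad field. -/
def BField.ofTetrad {X : OrientedComplex V} (e : Tetrad X) : BField X where
  val ν s := hodge (wedge (e ν s.1.1) (e ν s.1.2))
  reverse ν s := by
    simp only [OWedge.reverse]
    rw [wedge_swap, hodge_neg]

/-- The holonomy `g_{∂s} = h_{l₂}⁻¹ k_{r₂}⁻¹ k_{r₁} h_{l₁}` around an oriented wedge. -/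
def holonomy [DecidableEq V] {X : OrientedComplex V} (h : HField X) (k : KField X) (ν : X.Atom) (s : OWedge) :
    SO31 :=
  (h ν s.1.2)⁻¹ * (k (X.r₂ ν s))⁻¹ * k (X.r₁ ν s) * h ν s.1.1

/-- `1/γ` for the Barbero-Immirzi parameter `γ ∈ ℝ ∪ {∞}`. -/
def invImmirzi : OnePoint ℝ → ℝ
  | none => 0
  | some γ => 1 / γ

section Models

variable {ι : Type*} [Fintype ι] [DecidableEq ι] (T : Module.Basis ι ℝ so31) (γ : OnePoint ℝ)
variable {X : OrientedComplex V}

/-- `θ_s^i = tr (T^i g_{∂s})`. -/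
def theta [DecidableEq V] (h : HField X) (k : KField X) (ν : X.Atom) (s : OWedge) (i : ι) : ℝ :=
  ((upper T i : Matrix (Fin 4) (Fin 4) ℝ) * soMat (holonomy h k ν s)).trace

/-- `P_{IJKL} = ε_{IJKL} - (1/2γ) ε_{IJMN} ε^{MN}_{KL}`. -/
def holstP (I J K L : Fin 4) : ℝ :=
  eps I J K L - (1 / 2 : ℝ) * invImmirzi γ * ∑ M, ∑ N, eps I J M N * epsUp M N K L

/-- The action of the `e`-model. -/
def actionE [DecidableEq V] (e : Tetrad X) (h : HField X) (k : KField X) : ℝ :=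
  ∑ ν : X.Atom, ∑ P : Fin 5, ∑ Q : Fin 5, ∑ s : OWedge, (sgnLLS P Q s : ℝ) *
    ∑ i, (∑ I, ∑ J, ∑ K, ∑ L, e ν P K * e ν Q L * bivec (T i) J I * holstP γ I J K L) *
      theta T h k ν s i

/-- The action of the `B`-models. -/
def actionB [DecidableEq V] (B : BField X) (h : HField X) (k : KField X) : ℝ :=
  ∑ ν : X.Atom, ∑ s : OWedge, ∑ s' : OWedge, (sgnSS s s' : ℝ) *
    ∑ i, (lowerComp T (B.val ν s) i - invImmirzi γ * lowerComp T (hodge (B.val ν s)) i) *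
      theta T h k ν s' i

/-! ## Geometricity conditions -/

/-- `ε_{IJKL} X^{IJ} Y^{KL}`. -/
def epsPair (A C : so31) : ℝ :=
  ∑ I, ∑ J, ∑ K, ∑ L, eps I J K L * bivec A I J * bivec C K L

/-- `∑ sgn(s, s') ε_{IJKL} B_s^{IJ} B_{s'}^{KL}` over the twelve unordered pairs `{s, s'}` of
transversal oriented wedges of the corner cell of `P` (the double sum meets each pair twice). -/
def pairSum (B : BField X) (ν : X.Atom) (P : Fin 5) : ℝ :=
  (1 / 2 : ℝ) * ∑ s : OWedge, ∑ s' : OWedge,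
    if s.InCell P ∧ s'.InCell P then
      (sgnSS s s' : ℝ) * epsPair (B.val ν s) (B.val ν s') else 0

/-- Condition GG1 at the corner cell of `P`. -/
def GG1 (B : BField X) (ν : X.Atom) (P : Fin 5) : Prop :=
  ∀ s s' : OWedge, s.InCell P → s'.InCell P →
    epsPair (B.val ν s) (B.val ν s') - (1 / 12 : ℝ) * (sgnSS s s' : ℝ) * pairSum B ν P = 0

/-- The 4-volume of the corner cell of `P`: the mean of `4⁴ sgn(s, s') ε_{IJKL} B_s^{IJ} B_{s'}^{KL}`
over the pairs of transversal wedges of the cell. -/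
def volume (B : BField X) (ν : X.Atom) (P : Fin 5) : ℝ := 4 ^ 4 * ((1 / 12 : ℝ) * pairSum B ν P)

/-- Under GG1 the 4-volume can be computed from any pair of transversal wedges of the cell. -/
theorem volume_eq_of_GG1 {B : BField X} {ν : X.Atom} {P : Fin 5} (hB : GG1 B ν P) (s s' : OWedge)
    (hs : s.InCell P) (hs' : s'.InCell P) (hss' : sgnSS s s' ≠ 0) :
    volume B ν P = 4 ^ 4 * ((sgnSS s s' : ℝ) * epsPair (B.val ν s) (B.val ν s')) := by
  have h1 : ∀ s s' : OWedge, sgnSS s s' = 0 ∨ sgnSS s s' * sgnSS s s' = 1 := by decide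
  have h2 := (h1 s s').resolve_left hss'
  have h3 : (sgnSS s s' : ℝ) * (sgnSS s s' : ℝ) = 1 := by exact_mod_cast h2
  have h4 := hB s s' hs hs'
  rw [volume, sub_eq_zero.1 h4]
  linear_combination (-(4 ^ 4 * (1 / 12) * pairSum B ν P)) * h3

/-- Condition GG2 at the corner cell of `P`. -/
def GG2 (B : BField X) (ν : X.Atom) (P : Fin 5) : Prop := 0 < volume B ν P

/-- The `(Q, R)` component `(1 / 12 V(c_P)) f_{ijk} ε^{ABCDP} B^i_{QA} B^j_{BC} B^k_{DR}` of the
bilinear form of the corner cell of `P`. -/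
def cellMetric (B : BField X) (ν : X.Atom) (P Q R : Fin 5) : ℝ :=
  1 / (12 * volume B ν P) *
    ∑ i, ∑ j, ∑ k, ∑ a : Fin 5, ∑ b : Fin 5, ∑ c : Fin 5, ∑ d : Fin 5,
      structConst T i j k * (levi ![a, b, c, d, P] : ℝ) *
        upperComp T (B.comp ν Q a) i * upperComp T (B.comp ν b c) j * upperComp T (B.comp ν d R) k

/-- The bilinear form of the corner cell of `P` as a matrix; its rows and columns belong to the
four lines of the cell. -/
def cellMetricMatrix (B : BField X) (ν : X.Atom) (P : Fin 5) : Matrix (Fin 4) (Fin 4) ℝ :=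
  Matrix.of fun a b => cellMetric T B ν P (P.succAbove a) (P.succAbove b)

/-- Condition GG3 at the corner cell of `P`: the bilinear form has the signature of `η`. -/
def GG3 (B : BField X) (ν : X.Atom) (P : Fin 5) : Prop :=
  sigPos (cellMetricMatrix T B ν P).toQuadraticForm' =
    sigPos η.toQuadraticForm' ∧
  sigNeg (cellMetricMatrix T B ν P).toQuadraticForm' =
    sigNeg η.toQuadraticForm'

/-- The tetrad field is nondegenerate at the corner cell of `P`: its four vectors there form a
basis of Minkowski space. -/
def NondegAt (e : Tetrad X) (ν : X.Atom) (P : Fin 5) : Prop :=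
  LinearIndependent ℝ (fun Q : {Q : Fin 5 // Q ≠ P} => e ν Q.1) ∧
  Submodule.span ℝ (Set.range fun Q : {Q : Fin 5 // Q ≠ P} => e ν Q.1) = ⊤

/-- The tetrad field is positively oriented at the corner cell of `P`: it sends every positively
oriented four tuple of lines of the cell to a positively oriented basis of Minkowski space. -/
def PosAt (e : Tetrad X) (ν : X.Atom) (P : Fin 5) : Prop :=
  ∀ a b c d : Fin 5, levi ![a, b, c, d, P] = 1 →
    0 < (Matrix.of ![e ν a, e ν b, e ν c, e ν d]).det

/-! ## Equivalence of models -/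

/-- The matrix entries of a curve in `SO(3,1)` are smooth at `0`. -/
def SmoothSO (g : ℝ → SO31) : Prop := ∀ I J, ContDiffAt ℝ ∞ (fun t => soMat (g t) I J) 0

/-- `(h', k')` is a smooth variation of the connection `(h, k)` that keeps `k` fixed at the
boundary. -/
def IsConnVariation (h : HField X) (k : KField X) (h' : ℝ → HField X) (k' : ℝ → KField X) : Prop :=
  h' 0 = h ∧ k' 0 = k ∧ (∀ ν P, SmoothSO fun t => h' t ν P) ∧ (∀ r, SmoothSO fun t => k' t r) ∧
  ∀ r : X.RLine, r.IsBoundary → ∀ t, k' t r = k r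

/-- `(e, h, k)` is a classical solution of the `e`-model restricted to the sector `E`: the action
is stationary with respect to all smooth variations inside the sector. -/
def StationaryE [DecidableEq V] (E : Set (Tetrad X)) (e : Tetrad X) (h : HField X) (k : KField X) : Prop :=
  ∀ (e' : ℝ → Tetrad X) (h' : ℝ → HField X) (k' : ℝ → KField X),
    e' 0 = e → (∀ ν P I, ContDiffAt ℝ ∞ (fun t => e' t ν P I) 0) → (∀ᶠ t in 𝓝 0, e' t ∈ E) →
    IsConnVariation h k h' k' →
    HasDerivAt (fun t => actionE T γ (e' t) (h' t) (k' t)) 0 0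

/-- `(B, h, k)` is a classical solution of the `B`-model with constraint set `C`: the action is
stationary with respect to all smooth variations that respect the constraints. -/
def StationaryB [DecidableEq V] (C : Set (BField X)) (B : BField X) (h : HField X) (k : KField X) : Prop :=
  ∀ (B' : ℝ → BField X) (h' : ℝ → HField X) (k' : ℝ → KField X),
    B' 0 = B →
    (∀ ν s I J, ContDiffAt ℝ ∞
      (fun t => ((B' t).val ν s : Matrix (Fin 4) (Fin 4) ℝ) I J) 0) →
    (∀ᶠ t in 𝓝 0, B' t ∈ C) →
    IsConnVariation h k h' k' →
    HasDerivAt (fun t => actionB T γ (B' t) (h' t) (k' t)) 0 0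

/-- The `B`-model with constraint set `C` is equivalent to the sector `E` of the `e`-model, by
means of `B_{PQ} = ∗(e_P ∧ e_Q)`: the constraint set consists of the `B` fields of the tetrad
fields in `E`, such a tetrad field is unique up to a sign for each 4-simplex, the actions agree
(for all connections), and so do the classical solutions. -/
structure ModelsEquivalent [DecidableEq V] (E : Set (Tetrad X)) (C : Set (BField X)) : Prop where
  image : BField.ofTetrad '' E = C
  unique : ∀ e ∈ E, ∀ e' ∈ E, BField.ofTetrad e = BField.ofTetrad e' ↔
    ∀ ν, e' ν = e ν ∨ e' ν = -e ν
  action : ∀ e ∈ E, ∀ h k, actionB T γ (BField.ofTetrad e) h k = actionE T γ e h k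
  solutions : ∀ e ∈ E, ∀ h k,
    StationaryB T γ C (BField.ofTetrad e) h k ↔ StationaryE T γ E e h k

end Models

end SimplicialGravity

end

noncomputable section

namespace SimplicialGravity

/-! The form `epsForm` on the six-dimensional space `so(3,1)` has signature (3,3), and its null
vectors are the simple bivectors. At a corner cell, GG1 with nonzero volume says that the three
wedges on one line and the three opposite wedges span isotropic 3-spaces in duality
(`IsHyperbolic`). Isotropic 3-spaces form two families: the bivectors u ∧ f through a fixed vector
u, and the Hodge duals of such a space. Here the Clifford relation `mul_hodge_add_mul_hodge` proves
this: one of the products X₀ ∗X₁ X₂ and ∗X₀ X₁ ∗X₂ is nonzero, and any nonzero vector in its image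
serves as u (`IsHyperbolic.exists_mulVec_eq_zero`). The remaining isotropy relations then force the
opposite wedges to be multiples of f ∧ f', after shifts of the f by multiples of u
(`IsHyperbolic.exists_wedge`). So the B field of a cell is ±(e ∧ e) or ±∗(e ∧ e)
(`exists_tetrad_of_epsForm`).

GG3 selects one of these four cases. The cubic form vanishes on ±(e ∧ e) (`cubicForm_wedge`),
whereas on s∗(e ∧ e) it is 24 s³ det(e) times the Gram matrix of e (`cubicForm_hodge_wedge`,
`cubicForm_smul`). The volume is quadratic in B and does not see s, so the cell metric is s/512
times the Gram matrix, which is Lorentzian of the right sign only for s = 1. GG2 merely tests the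
sign of det(e), relative to the orientation of the cell.

Two corner cells of a 4-simplex share three lines, and three independent vectors are fixed by their
wedge products up to a common sign (`exists_sign`). Hence the cell frames fit together to five
vectors, unique up to one sign per 4-simplex (`exists_wedge_of_cells`, `ofTetrad_eq_iff`).

The actions agree term by term (`actionB_ofTetrad`). Smooth variations of e clearly give smooth
variations of B. Conversely, the products of components of two tetrad vectors are rational functions
of B, so a smooth curve of B fields lifts after one square root (`exists_smooth_lift`), and the
stationary points correspond. -/

/-! ## Coordinates on `so(3,1)` -/

/-- The element of `so(3,1)` with bivector components
`X^{01}, X^{02}, X^{03}, X^{23}, X^{31}, X^{12}`. -/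
def ofComps (a b c d f g : ℝ) : so31 :=
  ⟨!![0, a, b, c; a, 0, g, -f; b, -g, 0, d; c, f, -d, 0], by
    rw [mem_so31]
    ext I J
    fin_cases I <;> fin_cases J <;> simp [η, Matrix.mul_apply, Fin.sum_univ_four]⟩

theorem coe_ofComps (a b c d f g : ℝ) : (ofComps a b c d f g : Matrix (Fin 4) (Fin 4) ℝ) =
    !![0, a, b, c; a, 0, g, -f; b, -g, 0, d; c, f, -d, 0] := rfl

theorem bivec_apply (X : so31) (I J : Fin 4) :
    bivec X I J = (X : Matrix (Fin 4) (Fin 4) ℝ) I J * ![-1, 1, 1, 1] J := by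
  rw [bivec, η, Matrix.mul_diagonal]

theorem bivec_swap (X : so31) (I J : Fin 4) : bivec X J I = -bivec X I J :=
  congrFun (congrFun (bivec_transpose X) I) J

theorem bivec_injective : Function.Injective bivec := by
  intro X Y h
  apply Subtype.ext
  have h2 : bivec X * η = bivec Y * η := by rw [h]
  simpa only [bivec, Matrix.mul_assoc, η_mul_η, Matrix.mul_one] using h2

theorem bivec_ofBivec (N : Matrix (Fin 4) (Fin 4) ℝ) (hN : Nᵀ = -N) :
    bivec (ofBivec N hN) = N := by
  rw [bivec, ofBivec, Matrix.mul_assoc, η_mul_η, Matrix.mul_one]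

theorem bivec_ofComps (a b c d f g : ℝ) : bivec (ofComps a b c d f g) =
    !![0, a, b, c; -a, 0, g, -f; -b, -g, 0, d; -c, f, -d, 0] := by
  ext I J
  rw [bivec_apply, coe_ofComps]
  fin_cases I <;> fin_cases J <;> simp

theorem eq_ofComps (X : so31) : X = ofComps (bivec X 0 1) (bivec X 0 2) (bivec X 0 3)
    (bivec X 2 3) (bivec X 3 1) (bivec X 1 2) := by
  apply bivec_injective
  rw [bivec_ofComps]
  have h (I : Fin 4) : bivec X I I = 0 := by
    have := bivec_swap X I I
    linarith
  ext I J
  fin_cases I <;> fin_cases J <;> simp [h, ← bivec_swap]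

theorem exists_ofComps (X : so31) : ∃ a b c d f g, X = ofComps a b c d f g :=
  ⟨_, _, _, _, _, _, eq_ofComps X⟩

theorem ofComps_add (a b c d f g a' b' c' d' f' g' : ℝ) :
    ofComps a b c d f g + ofComps a' b' c' d' f' g' =
      ofComps (a + a') (b + b') (c + c') (d + d') (f + f') (g + g') := by
  apply Subtype.ext
  ext I J
  simp only [AddMemClass.coe_add, coe_ofComps]
  fin_cases I <;> fin_cases J <;> simp <;> ring

theorem ofComps_smul (r a b c d f g : ℝ) :
    r • ofComps a b c d f g = ofComps (r * a) (r * b) (r * c) (r * d) (r * f) (r * g) := by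
  apply Subtype.ext
  ext I J
  simp only [SetLike.val_smul, coe_ofComps]
  fin_cases I <;> fin_cases J <;> simp

theorem ofComps_neg (a b c d f g : ℝ) :
    -ofComps a b c d f g = ofComps (-a) (-b) (-c) (-d) (-f) (-g) := by
  rw [← neg_one_smul ℝ, ofComps_smul]
  simp only [neg_mul, one_mul]

theorem eps_ofComps_sum (a b c d f g : ℝ) (I J : Fin 4) :
    ∑ K, ∑ L, eps I J K L * bivec (ofComps a b c d f g) K L =
      (!![0, -2 * d, -2 * f, -2 * g; 2 * d, 0, -2 * c, 2 * b; 2 * f, 2 * c, 0, -2 * a;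
        2 * g, -2 * b, 2 * a, 0] : Matrix (Fin 4) (Fin 4) ℝ) I J := by
  have h (I J K L : Fin 4) : eps I J K L = -(levi ![I, J, K, L] : ℝ) := rfl
  -- The six pairs of positions are listed explicitly so that `simp` can evaluate the symbol on
  -- numerals.
  have hl : ∀ I J K L : Fin 4, levi ![I, J, K, L] =
      ∏ p ∈ {(0, 1), (0, 2), (0, 3), (1, 2), (1, 3), ((2, 3) : Fin 4 × Fin 4)},
        Int.sign (((![I, J, K, L] p.2 : ℕ) : ℤ) - ((![I, J, K, L] p.1 : ℕ) : ℤ)) := by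
    decide
  have h2 : Int.sign 2 = 1 := rfl
  have h3 : Int.sign 3 = 1 := rfl
  rw [bivec_ofComps]
  fin_cases I <;> fin_cases J <;>
    simp [Fin.sum_univ_four, h, hl, h2, h3] <;> ring

theorem hodge_ofComps (a b c d f g : ℝ) :
    hodge (ofComps a b c d f g) = ofComps d f g (-a) (-b) (-c) := by
  apply bivec_injective
  rw [hodge, bivec_ofBivec]
  ext I J
  simp only [epsUp, mul_assoc, ← Finset.mul_sum, eps_ofComps_sum, Matrix.of_apply, η]
  rw [bivec_ofComps]
  fin_cases I <;> fin_cases J <;> simp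

theorem epsPair_ofComps (a b c d f g a' b' c' d' f' g' : ℝ) :
    epsPair (ofComps a b c d f g) (ofComps a' b' c' d' f' g') =
      -4 * (a * d' + b * f' + c * g' + d * a' + f * b' + g * c') := by
  have h (X Y : so31) : epsPair X Y =
      ∑ I, ∑ J, bivec X I J * ∑ K, ∑ L, eps I J K L * bivec Y K L := by
    simp only [epsPair, Finset.mul_sum]
    refine Finset.sum_congr rfl fun I _ => Finset.sum_congr rfl fun J _ =>
      Finset.sum_congr rfl fun K _ => Finset.sum_congr rfl fun L _ => by ring
  simp only [h, eps_ofComps_sum]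
  rw [bivec_ofComps]
  simp [Fin.sum_univ_four]
  ring

theorem wedge_eq_ofComps (u v : Mink) : wedge u v =
    ofComps (u 0 * v 1 - u 1 * v 0) (u 0 * v 2 - u 2 * v 0) (u 0 * v 3 - u 3 * v 0)
      (u 2 * v 3 - u 3 * v 2) (u 3 * v 1 - u 1 * v 3) (u 1 * v 2 - u 2 * v 1) := by
  conv_lhs => rw [eq_ofComps (wedge u v)]
  simp only [wedge, bivec_ofBivec, Matrix.of_apply]

theorem traceForm_apply (X Y : so31) : traceForm X Y =
    ((X : Matrix (Fin 4) (Fin 4) ℝ) * (Y : Matrix (Fin 4) (Fin 4) ℝ)).trace := rfl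

theorem traceForm_ofComps (a b c d f g a' b' c' d' f' g' : ℝ) :
    traceForm (ofComps a b c d f g) (ofComps a' b' c' d' f' g') =
      2 * (a * a' + b * b' + c * c' - d * d' - f * f' - g * g') := by
  rw [traceForm_apply, coe_ofComps, coe_ofComps]
  simp [Matrix.trace, Fin.sum_univ_four]
  ring

/-! ## The Hodge dual and the form `ε_{IJKL} X^{IJ} Y^{KL}` -/

theorem hodge_hodge (X : so31) : hodge (hodge X) = -X := by
  obtain ⟨a, b, c, d, f, g, rfl⟩ := exists_ofComps X
  rw [hodge_ofComps, hodge_ofComps, ofComps_neg]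

theorem hodge_smul (r : ℝ) (X : so31) : hodge (r • X) = r • hodge X := by
  obtain ⟨a, b, c, d, f, g, rfl⟩ := exists_ofComps X
  simp only [hodge_ofComps, ofComps_smul, mul_neg]

theorem hodge_injective : Function.Injective hodge := by
  intro X Y h
  rw [← neg_inj, ← hodge_hodge, h, hodge_hodge]

theorem hodge_zero : hodge 0 = 0 := by
  simpa using hodge_smul 0 0

/-- The symmetric bilinear form `ε_{IJKL} X^{IJ} Y^{KL}` on `so(3,1)`. -/
def epsForm : LinearMap.BilinForm ℝ so31 :=
  LinearMap.mk₂ ℝ epsPair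
    (by
      intro X Y Z
      obtain ⟨a, b, c, d, f, g, rfl⟩ := exists_ofComps X
      obtain ⟨a', b', c', d', f', g', rfl⟩ := exists_ofComps Y
      obtain ⟨a'', b'', c'', d'', f'', g'', rfl⟩ := exists_ofComps Z
      simp only [ofComps_add, epsPair_ofComps]
      ring)
    (by
      intro r X Y
      obtain ⟨a, b, c, d, f, g, rfl⟩ := exists_ofComps X
      obtain ⟨a', b', c', d', f', g', rfl⟩ := exists_ofComps Y
      simp only [ofComps_smul, epsPair_ofComps, smul_eq_mul]
      ring)
    (by
      intro X Y Z
      obtain ⟨a, b, c, d, f, g, rfl⟩ := exists_ofComps X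
      obtain ⟨a', b', c', d', f', g', rfl⟩ := exists_ofComps Y
      obtain ⟨a'', b'', c'', d'', f'', g'', rfl⟩ := exists_ofComps Z
      simp only [ofComps_add, epsPair_ofComps]
      ring)
    (by
      intro r X Y
      obtain ⟨a, b, c, d, f, g, rfl⟩ := exists_ofComps X
      obtain ⟨a', b', c', d', f', g', rfl⟩ := exists_ofComps Y
      simp only [ofComps_smul, epsPair_ofComps, smul_eq_mul]
      ring)

theorem epsPair_eq_epsForm (X Y : so31) : epsPair X Y = epsForm X Y := rfl

theorem epsForm_ofComps (a b c d f g a' b' c' d' f' g' : ℝ) :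
    epsForm (ofComps a b c d f g) (ofComps a' b' c' d' f' g') =
      -4 * (a * d' + b * f' + c * g' + d * a' + f * b' + g * c') :=
  epsPair_ofComps ..

theorem epsForm_comm (X Y : so31) : epsForm X Y = epsForm Y X := by
  obtain ⟨a, b, c, d, f, g, rfl⟩ := exists_ofComps X
  obtain ⟨a', b', c', d', f', g', rfl⟩ := exists_ofComps Y
  simp only [epsForm_ofComps]
  ring

/-- Duality is an anti-isometry, so it exchanges the two families of isotropic 3-spaces and reverses
the sign of the pairing v. -/
theorem epsForm_hodge_hodge (X Y : so31) : epsForm (hodge X) (hodge Y) = -epsForm X Y := by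
  obtain ⟨a, b, c, d, f, g, rfl⟩ := exists_ofComps X
  obtain ⟨a', b', c', d', f', g', rfl⟩ := exists_ofComps Y
  simp only [hodge_ofComps, epsForm_ofComps]
  ring

/-- The determinant with rows `u, v, w, x`. -/
def det4 (u v w x : Mink) : ℝ := (Matrix.of ![u, v, w, x]).det

theorem det4_eq (u v w x : Mink) : det4 u v w x =
    (u 0 * v 1 - u 1 * v 0) * (w 2 * x 3 - w 3 * x 2) +
    (u 0 * v 2 - u 2 * v 0) * (w 3 * x 1 - w 1 * x 3) +
    (u 0 * v 3 - u 3 * v 0) * (w 1 * x 2 - w 2 * x 1) +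
    (u 2 * v 3 - u 3 * v 2) * (w 0 * x 1 - w 1 * x 0) +
    (u 3 * v 1 - u 1 * v 3) * (w 0 * x 2 - w 2 * x 0) +
    (u 1 * v 2 - u 2 * v 1) * (w 0 * x 3 - w 3 * x 0) := by
  simp [det4, Matrix.det_succ_row_zero, Fin.sum_univ_succ, Fin.succAbove]
  ring

theorem epsForm_wedge_wedge (u v w x : Mink) :
    epsForm (wedge u v) (wedge w x) = -4 * det4 u v w x := by
  simp only [wedge_eq_ofComps, epsForm_ofComps, det4_eq]

/-- The Clifford relation of `so(3,1)`, regarded as a space of chiral blocks of gamma matrices of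
signature `(3,3)`. -/
theorem mul_hodge_add_mul_hodge (X Y : so31) :
    (X : Matrix (Fin 4) (Fin 4) ℝ) * (hodge Y : Matrix (Fin 4) (Fin 4) ℝ) +
      (Y : Matrix (Fin 4) (Fin 4) ℝ) * (hodge X : Matrix (Fin 4) (Fin 4) ℝ) =
      (-(1 / 4) * epsForm X Y) • 1 := by
  obtain ⟨a, b, c, d, f, g, rfl⟩ := exists_ofComps X
  obtain ⟨a', b', c', d', f', g', rfl⟩ := exists_ofComps Y
  rw [hodge_ofComps, hodge_ofComps, epsForm_ofComps]
  simp only [coe_ofComps]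
  ext I J
  fin_cases I <;> fin_cases J <;>
    simp <;> ring

/-- The Clifford relation for the opposite chirality: apply the previous one to the duals, where
both ∗∗ and the form contribute a sign. -/
theorem hodge_mul_add_hodge_mul (X Y : so31) :
    (hodge X : Matrix (Fin 4) (Fin 4) ℝ) * (Y : Matrix (Fin 4) (Fin 4) ℝ) +
      (hodge Y : Matrix (Fin 4) (Fin 4) ℝ) * (X : Matrix (Fin 4) (Fin 4) ℝ) =
      (-(1 / 4) * epsForm X Y) • 1 := by
  have h := mul_hodge_add_mul_hodge (hodge X) (hodge Y)
  rw [hodge_hodge, hodge_hodge, epsForm_hodge_hodge] at h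
  simp only [NegMemClass.coe_neg, mul_neg, neg_smul, neg_mul, neg_neg] at h ⊢
  rw [← h]
  abel

/-- Duality squares to −1 and acts as multiplication by a complex unit under so(3,1) ≅ sl(2,ℂ),
whose bracket is complex bilinear. -/
theorem hodge_bracket (X Y : so31) : ⁅hodge X, Y⁆ = hodge ⁅X, Y⁆ := by
  have hb (a b c d f g a' b' c' d' f' g' : ℝ) :
      ⁅ofComps a b c d f g, ofComps a' b' c' d' f' g'⁆ =
        ofComps (b' * g - c' * f - (g' * b - f' * c)) (c' * d - a' * g - (d' * c - g' * a))
          (a' * f - b' * d - (f' * a - d' * b)) (b * c' - c * b' - (f * g' - g * f'))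
          (c * a' - a * c' - (g * d' - d * g')) (a * b' - b * a' - (d * f' - f * d')) := by
    apply Subtype.ext
    rw [LieSubalgebra.coe_bracket, Ring.lie_def]
    simp only [coe_ofComps]
    ext I J
    fin_cases I <;> fin_cases J <;>
      simp <;> ring
  obtain ⟨a, b, c, d, f, g, rfl⟩ := exists_ofComps X
  obtain ⟨a', b', c', d', f', g', rfl⟩ := exists_ofComps Y
  simp only [hodge_ofComps, hb]
  congr 1 <;> ring

/-! ### Brackets and traces of wedge products -/

/-- The Minkowski inner product. -/
def mdot (u v : Mink) : ℝ := u ⬝ᵥ η *ᵥ v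

theorem mdot_eq (u v : Mink) : mdot u v = -(u 0 * v 0) + u 1 * v 1 + u 2 * v 2 + u 3 * v 3 := by
  simp [mdot, η, Matrix.mulVec_diagonal, dotProduct, Fin.sum_univ_four]

theorem mdot_comm (u v : Mink) : mdot u v = mdot v u := by
  simp only [mdot_eq]
  ring

theorem wedge_apply (u v : Mink) (I J : Fin 4) :
    (wedge u v : Matrix (Fin 4) (Fin 4) ℝ) I J = (u I * v J - u J * v I) * ![-1, 1, 1, 1] J := by
  simp only [wedge, ofBivec, η, Matrix.mul_diagonal, Matrix.of_apply]

theorem bracket_wedge (u v w x : Mink) : ⁅wedge u v, wedge w x⁆ =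
    mdot v w • wedge u x - mdot v x • wedge u w - mdot u w • wedge v x + mdot u x • wedge v w := by
  apply Subtype.ext
  ext I J
  simp only [LieSubalgebra.coe_bracket, Ring.lie_def, Matrix.sub_apply, Matrix.mul_apply,
    wedge_apply, Fin.sum_univ_four, AddMemClass.coe_add, AddSubgroupClass.coe_sub,
    SetLike.val_smul, Matrix.add_apply, Matrix.smul_apply, smul_eq_mul, mdot_eq]
  simp
  ring

theorem traceForm_wedge_wedge (u v w x : Mink) :
    traceForm (wedge u v) (wedge w x) = 2 * (mdot v w * mdot u x - mdot u w * mdot v x) := by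
  simp only [wedge_eq_ofComps, traceForm_ofComps, mdot_eq]
  ring

theorem traceForm_wedge_hodge_wedge (u v w x : Mink) :
    traceForm (wedge u v) (hodge (wedge w x)) = 2 * det4 u v w x := by
  simp only [wedge_eq_ofComps, hodge_ofComps, traceForm_ofComps, det4_eq]
  ring

theorem traceForm_bracket_wedge (u v w x y z : Mink) :
    traceForm ⁅wedge u v, wedge w x⁆ (wedge y z) =
      2 * (mdot v w * (mdot x y * mdot u z - mdot u y * mdot x z) -
        mdot v x * (mdot w y * mdot u z - mdot u y * mdot w z) -
        mdot u w * (mdot x y * mdot v z - mdot v y * mdot x z) +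
        mdot u x * (mdot w y * mdot v z - mdot v y * mdot w z)) := by
  rw [bracket_wedge]
  simp only [map_add, map_sub, map_smul, LinearMap.add_apply, LinearMap.sub_apply,
    LinearMap.smul_apply, traceForm_wedge_wedge, smul_eq_mul]
  ring

/-- Two of the three duals come out of the bracket and cancel to −1. The third turns the traces of
wedge products into determinants. -/
theorem traceForm_bracket_hodge_wedge (u v w x y z : Mink) :
    traceForm ⁅hodge (wedge u v), hodge (wedge w x)⁆ (hodge (wedge y z)) =
      -2 * (mdot v w * det4 u x y z - mdot v x * det4 u w y z -
        mdot u w * det4 v x y z + mdot u x * det4 v w y z) := by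
  rw [hodge_bracket, ← lie_skew, hodge_bracket, hodge_neg, hodge_hodge, neg_neg, ← lie_skew,
    bracket_wedge]
  simp only [map_add, map_sub, map_neg, map_smul, LinearMap.add_apply, LinearMap.sub_apply,
    LinearMap.smul_apply, LinearMap.neg_apply, traceForm_wedge_hodge_wedge, smul_eq_mul]
  ring

/-! ## Equality of the actions -/

theorem sum_eps_bivec (Y Z : so31) :
    ∑ I, ∑ J, bivec Y J I * ∑ K, ∑ L, eps I J K L * bivec Z K L =
      2 * traceForm (hodge Z) Y := by
  obtain ⟨a, b, c, d, f, g, rfl⟩ := exists_ofComps Y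
  obtain ⟨a', b', c', d', f', g', rfl⟩ := exists_ofComps Z
  simp only [eps_ofComps_sum, hodge_ofComps, traceForm_ofComps]
  rw [bivec_ofComps]
  simp [Fin.sum_univ_four]
  ring

theorem eps_swap_right (I J K L : Fin 4) : eps I J L K = -eps I J K L := by
  have h : levi ![I, J, L, K] = -levi ![I, J, K, L] := by
    revert I J K L; decide
  simp only [eps, h]
  push_cast
  ring

theorem sum_eps_mul (u v : Mink) (I J : Fin 4) :
    ∑ K, ∑ L, eps I J K L * (u K * v L) =
      (1 / 2 : ℝ) * ∑ K, ∑ L, eps I J K L * bivec (wedge u v) K L := by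
  have h : ∑ K, ∑ L, eps I J K L * (u L * v K) = -∑ K, ∑ L, eps I J K L * (u K * v L) := by
    rw [Finset.sum_comm, ← Finset.sum_neg_distrib]
    refine Finset.sum_congr rfl fun K _ => ?_
    rw [← Finset.sum_neg_distrib]
    refine Finset.sum_congr rfl fun L _ => ?_
    rw [eps_swap_right]
    ring
  simp only [wedge, bivec_ofBivec, Matrix.of_apply, mul_sub, Finset.sum_sub_distrib]
  rw [h]
  ring

theorem bivec_hodge_wedge (u v : Mink) (I J : Fin 4) :
    bivec (hodge (wedge u v)) I J = ∑ K, ∑ L, epsUp I J K L * (u K * v L) := by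
  have h := sum_eps_mul u v I J
  rw [hodge, bivec_ofBivec, Matrix.of_apply]
  simp only [epsUp, mul_assoc, ← Finset.mul_sum] at h ⊢
  rw [h]
  ring

/-- Contracting one ε with u ⊗ v produces ∗(u ∧ v); the double contraction in the Immirzi term
produces ∗∗(u ∧ v). This is exactly the combination B − (1/γ)∗B of the `B`-model. -/
theorem sum_holstP (γ : OnePoint ℝ) (u v : Mink) (Y : so31) :
    ∑ I, ∑ J, ∑ K, ∑ L, u K * v L * bivec Y J I * holstP γ I J K L =
      traceForm (hodge (wedge u v)) Y -
        invImmirzi γ * traceForm (hodge (hodge (wedge u v))) Y := by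
  have h1 (I J : Fin 4) : ∑ K, ∑ L, u K * v L * ∑ M, ∑ N, eps I J M N * epsUp M N K L =
      ∑ M, ∑ N, eps I J M N * bivec (hodge (wedge u v)) M N := by
    simp only [bivec_hodge_wedge, Finset.mul_sum]
    calc _ = ∑ K, ∑ M, ∑ N, ∑ L, u K * v L * (eps I J M N * epsUp M N K L) := by
          refine Finset.sum_congr rfl fun K _ => ?_
          rw [Finset.sum_comm]
          exact Finset.sum_congr rfl fun M _ => Finset.sum_comm
      _ = ∑ M, ∑ N, ∑ K, ∑ L, u K * v L * (eps I J M N * epsUp M N K L) := by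
          rw [Finset.sum_comm]
          exact Finset.sum_congr rfl fun M _ => Finset.sum_comm
      _ = _ := by
          refine Finset.sum_congr rfl fun M _ => Finset.sum_congr rfl fun N _ =>
            Finset.sum_congr rfl fun K _ => Finset.sum_congr rfl fun L _ => ?_
          ring
  have h2 (I J : Fin 4) : ∑ K, ∑ L, u K * v L * bivec Y J I * holstP γ I J K L =
      (1 / 2 : ℝ) * (bivec Y J I * ∑ K, ∑ L, eps I J K L * bivec (wedge u v) K L) -
      (1 / 2 : ℝ) * invImmirzi γ *
        (bivec Y J I * ∑ M, ∑ N, eps I J M N * bivec (hodge (wedge u v)) M N) := by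
    rw [← h1 I J, show ∀ a b : ℝ, (1 / 2 : ℝ) * (a * b) = a * ((1 / 2 : ℝ) * b) by intros; ring,
      ← sum_eps_mul]
    simp only [Finset.mul_sum _ _ (bivec Y J I),
      Finset.mul_sum _ _ ((1 / 2 : ℝ) * invImmirzi γ), ← Finset.sum_sub_distrib]
    refine Finset.sum_congr rfl fun K _ => Finset.sum_congr rfl fun L _ => ?_
    rw [holstP]
    ring
  simp only [h2, Finset.sum_sub_distrib, ← Finset.mul_sum, sum_eps_bivec]
  ring

theorem lowerComp_eq {ι : Type*} [Fintype ι] [DecidableEq ι] (T : Module.Basis ι ℝ so31)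
    (X : so31) (i : ι) : lowerComp T X i = traceForm X (T i) :=
  LinearMap.BilinForm.dualBasis_repr_apply ..

theorem sgn4_self (P R S : Fin 5) : sgn4 P P R S = 0 := by
  revert P R S
  decide

/-- A sum over pairs of lines is a sum over oriented wedges if equal lines do not contribute. -/
theorem sum_lines_eq_sum_wedges (F : Fin 5 → Fin 5 → ℝ) (hF : ∀ P, F P P = 0) :
    ∑ P, ∑ Q, F P Q = ∑ s : OWedge, F s.1.1 s.1.2 := by
  rw [← Fintype.sum_prod_type', ← Finset.sum_filter_of_ne (p := fun p => p.1 ≠ p.2)]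
  · exact Finset.sum_subtype _ (by simp) _
  · rintro ⟨P, Q⟩ _ h hPQ
    obtain rfl : P = Q := hPQ
    exact h (hF P)

/-- The terms with two equal lines carry the sign 0, so the sum over pairs of lines is a sum over
wedges and the summands can be compared by `sum_holstP`. -/
theorem actionB_ofTetrad {V : Type*} [DecidableEq V] {X : OrientedComplex V}
    {ι : Type*} [Fintype ι] [DecidableEq ι] (T : Module.Basis ι ℝ so31) (γ : OnePoint ℝ)
    (e : Tetrad X) (h : HField X) (k : KField X) :
    actionB T γ (BField.ofTetrad e) h k = actionE T γ e h k := by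
  refine Finset.sum_congr rfl fun ν _ => ?_
  rw [sum_lines_eq_sum_wedges]
  · refine Finset.sum_congr rfl fun s _ => Finset.sum_congr rfl fun s' _ => ?_
    simp only [sum_holstP, lowerComp_eq]
    rfl
  · intro P
    refine Finset.sum_eq_zero fun s _ => ?_
    rw [sgnLLS, sgn4_self, Int.cast_zero, zero_mul]

/-! ## Reconstruction of a tetrad from its bivectors -/

theorem wedge_add_right (u v w : Mink) : wedge u (v + w) = wedge u v + wedge u w := by
  simp only [wedge_eq_ofComps, ofComps_add, Pi.add_apply]
  congr 1 <;> ring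

theorem wedge_smul_right (r : ℝ) (u v : Mink) : wedge u (r • v) = r • wedge u v := by
  simp only [wedge_eq_ofComps, ofComps_smul, Pi.smul_apply, smul_eq_mul]
  congr 1 <;> ring

theorem wedge_smul_left (r : ℝ) (u v : Mink) : wedge (r • u) v = r • wedge u v := by
  simp only [wedge_eq_ofComps, ofComps_smul, Pi.smul_apply, smul_eq_mul]
  congr 1 <;> ring

theorem wedge_self (u : Mink) : wedge u u = 0 := by
  have h := wedge_swap u u
  rw [eq_neg_iff_add_eq_zero, ← two_smul ℝ] at h
  exact (smul_eq_zero.1 h).resolve_left two_ne_zero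

/-- The hypothesis says that the exterior product of u and X vanishes, so X is divisible by u. -/
theorem exists_eq_wedge_of_hodge_mulVec_eq_zero {X : so31} {u : Mink} (hu : u ≠ 0)
    (h : (hodge X : Matrix (Fin 4) (Fin 4) ℝ) *ᵥ u = 0) : ∃ f, X = wedge u f := by
  obtain ⟨a, b, c, d, f, g, rfl⟩ := exists_ofComps X
  rw [hodge_ofComps, coe_ofComps] at h
  have h0 := congrFun h 0
  have h1 := congrFun h 1
  have h2 := congrFun h 2
  have h3 := congrFun h 3
  simp [Matrix.mulVec, dotProduct, Fin.sum_univ_four] at h0 h1 h2 h3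
  obtain ⟨K, hK⟩ := Function.ne_iff.1 hu
  -- The factor is determined only modulo u; normalising its K-th component to 0 leaves f^J = X^{KJ}
  -- / u^K.
  refine ⟨fun J => bivec (ofComps a b c d f g) K J / u K, ?_⟩
  rw [bivec_ofComps, wedge_eq_ofComps]
  fin_cases K <;> simp at hK ⊢ <;> congr 1 <;> field_simp <;> linarith

/-- The relations between the bivectors `X i` of three lines with a common first line and the
bivectors `Y i` of the opposite wedges of a corner cell. -/
structure IsHyperbolic (X Y : Fin 3 → so31) (v : ℝ) : Prop where
  left : ∀ i j, epsForm (X i) (X j) = 0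
  right : ∀ i j, epsForm (Y i) (Y j) = 0
  mixed : ∀ i j, epsForm (X i) (Y j) = if i = j then v else 0

theorem IsHyperbolic.map_hodge {X Y : Fin 3 → so31} {v : ℝ} (h : IsHyperbolic X Y v) :
    IsHyperbolic (fun i => hodge (X i)) (fun i => hodge (Y i)) (-v) where
  left i j := by rw [epsForm_hodge_hodge, h.left, neg_zero]
  right i j := by rw [epsForm_hodge_hodge, h.right, neg_zero]
  mixed i j := by
    rw [epsForm_hodge_hodge, h.mixed]
    split_ifs <;> simp

/-- On an isotropic family the Clifford relation makes the factors anticommute and square to zero.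
Multiplying the triple product on the left by any ∗X i moves that factor next to its own copy, which
gives 0. So every vector in the image of the product is a common null vector. -/
theorem IsHyperbolic.exists_mulVec_eq_zero_of_ne_zero {X Y : Fin 3 → so31} {v : ℝ}
    (h : IsHyperbolic X Y v)
    (hH : (X 0 : Matrix (Fin 4) (Fin 4) ℝ) * (hodge (X 1)).1 * (X 2).1 ≠ 0) :
    ∃ u : Mink, u ≠ 0 ∧ ∀ i, (hodge (X i)).1 *ᵥ u = 0 := by
  have hr (i j : Fin 3) : (X i).1 * (hodge (X j)).1 =
      -((X j).1 * (hodge (X i)).1) := by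
    rw [eq_neg_iff_add_eq_zero, mul_hodge_add_mul_hodge, h.left]
    simp
  have hl (i j : Fin 3) : (hodge (X i)).1 * (X j).1 =
      -((hodge (X j)).1 * (X i).1) := by
    rw [eq_neg_iff_add_eq_zero, hodge_mul_add_hodge_mul, h.left]
    simp
  have hr0 (i : Fin 3) : (X i).1 * (hodge (X i)).1 = 0 := by
    have h2 := hr i i
    rw [eq_neg_iff_add_eq_zero, ← two_smul ℝ] at h2
    exact (smul_eq_zero.1 h2).resolve_left two_ne_zero
  have hl0 (i : Fin 3) : (hodge (X i)).1 * (X i).1 = 0 := by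
    have h2 := hl i i
    rw [eq_neg_iff_add_eq_zero, ← two_smul ℝ] at h2
    exact (smul_eq_zero.1 h2).resolve_left two_ne_zero
  obtain ⟨w, hw⟩ : ∃ w : Mink,
      ((X 0 : Matrix (Fin 4) (Fin 4) ℝ) * (hodge (X 1)).1 * (X 2).1) *ᵥ w ≠ 0 := by
    by_contra! hc
    exact hH (Matrix.ext_of_mulVec_single fun i => by rw [hc, Matrix.zero_mulVec])
  have k0 : (hodge (X 0)).1 *
      ((X 0 : Matrix (Fin 4) (Fin 4) ℝ) * (hodge (X 1)).1 * (X 2).1) = 0 := by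
    rw [Matrix.mul_assoc, ← Matrix.mul_assoc, hl0, Matrix.zero_mul]
  have k1 : (hodge (X 1)).1 *
      ((X 0 : Matrix (Fin 4) (Fin 4) ℝ) * (hodge (X 1)).1 * (X 2).1) = 0 := by
    rw [Matrix.mul_assoc, ← Matrix.mul_assoc, hl, Matrix.neg_mul, Matrix.mul_assoc,
      ← Matrix.mul_assoc (X 1).1, hr0, Matrix.zero_mul, Matrix.mul_zero, neg_zero]
  have k2 : (hodge (X 2)).1 *
      ((X 0 : Matrix (Fin 4) (Fin 4) ℝ) * (hodge (X 1)).1 * (X 2).1) = 0 := by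
    rw [Matrix.mul_assoc, hl 1 2, Matrix.mul_neg, Matrix.mul_neg, ← Matrix.mul_assoc, hl 2 0,
      Matrix.neg_mul, neg_neg, Matrix.mul_assoc, ← Matrix.mul_assoc (X 2).1, hr0,
      Matrix.zero_mul, Matrix.mul_zero]
  refine ⟨_, hw, fun i => ?_⟩
  rw [Matrix.mulVec_mulVec]
  fin_cases i
  · exact (congrArg (· *ᵥ w) k0).trans (Matrix.zero_mulVec _)
  · exact (congrArg (· *ᵥ w) k1).trans (Matrix.zero_mulVec _)
  · exact (congrArg (· *ᵥ w) k2).trans (Matrix.zero_mulVec _)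

section

variable {X Y : Fin 3 → so31} {v : ℝ}

theorem IsHyperbolic.mul_hodge_swap (h : IsHyperbolic X Y v) {i j : Fin 3} (hij : i ≠ j) :
    (X i).1 * (hodge (Y j)).1 = -((Y j).1 * (hodge (X i)).1) := by
  rw [eq_neg_iff_add_eq_zero, mul_hodge_add_mul_hodge, h.mixed, if_neg hij]
  simp

theorem IsHyperbolic.hodge_mul_swap (h : IsHyperbolic X Y v) {i j : Fin 3} (hij : i ≠ j) :
    (hodge (X i)).1 * (Y j).1 = -((hodge (Y j)).1 * (X i).1) := by
  rw [eq_neg_iff_add_eq_zero, hodge_mul_add_hodge_mul, h.mixed, if_neg hij]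
  simp

theorem IsHyperbolic.hodge_mul_self (h : IsHyperbolic X Y v) (i : Fin 3) :
    (hodge (X i)).1 * (Y i).1 = (-(1 / 4) * v) • 1 - (hodge (Y i)).1 * (X i).1 := by
  rw [eq_sub_iff_add_eq, hodge_mul_add_hodge_mul, h.mixed, if_pos rfl]

/-- Y 2 acts as an annihilation operator for X 2: moving it through ∗X₀ X₁ ∗X₂ leaves v times ∗X₀
X₁, up to a constant, and a multiple of the other triple product. -/
theorem IsHyperbolic.hodge_mul_eq_zero (hv : v ≠ 0) (h : IsHyperbolic X Y v)
    (h1 : (X 0).1 * (hodge (X 1)).1 * (X 2).1 = 0)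
    (h2 : (hodge (X 0)).1 * (X 1).1 * (hodge (X 2)).1 = 0) :
    (hodge (X 0)).1 * (X 1).1 = 0 := by
  have e : (hodge (X 0)).1 * (X 1).1 * (hodge (X 2)).1 * (Y 2).1 =
      (-(1 / 4) * v) • ((hodge (X 0)).1 * (X 1).1) -
        (hodge (Y 2)).1 * ((X 0).1 * (hodge (X 1)).1 * (X 2).1) := by
    rw [Matrix.mul_assoc, h.hodge_mul_self, Matrix.mul_sub, Matrix.mul_smul, Matrix.mul_one,
      Matrix.mul_assoc, ← Matrix.mul_assoc (X 1).1, h.mul_hodge_swap (by decide), Matrix.neg_mul,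
      Matrix.mul_neg, ← Matrix.mul_assoc, ← Matrix.mul_assoc, h.hodge_mul_swap (by decide)]
    simp only [Matrix.neg_mul, neg_neg, Matrix.mul_assoc]
  rw [h1, h2, Matrix.mul_zero, Matrix.zero_mul, sub_zero] at e
  exact (smul_eq_zero.1 e.symm).resolve_left (by simpa using hv)

/-- The alternatives are the two families of isotropic 3-spaces. If the triple products of both
chiralities vanished, stripping off one factor at a time with Y 2 and Y 1 would give X 0 = 0,
contrary to its pairing v with Y 0. -/
theorem IsHyperbolic.exists_mulVec_eq_zero (hv : v ≠ 0) (h : IsHyperbolic X Y v) :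
    (∃ u : Mink, u ≠ 0 ∧ ∀ i, (hodge (X i)).1 *ᵥ u = 0) ∨
      ∃ u : Mink, u ≠ 0 ∧ ∀ i, (hodge (hodge (X i))).1 *ᵥ u = 0 := by
  by_cases h1 : (X 0).1 * (hodge (X 1)).1 * (X 2).1 = 0
  swap
  · exact .inl (h.exists_mulVec_eq_zero_of_ne_zero h1)
  by_cases h2 : (hodge (X 0)).1 * (X 1).1 * (hodge (X 2)).1 = 0
  swap
  · refine .inr (h.map_hodge.exists_mulVec_eq_zero_of_ne_zero ?_)
    rw [hodge_hodge]
    simpa using h2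
  exfalso
  have h3 := h.hodge_mul_eq_zero hv h1 h2
  have h4 : (X 0).1 * (hodge (X 1)).1 = 0 := by
    have h5 := h.map_hodge.hodge_mul_eq_zero (neg_ne_zero.2 hv)
      (by simpa [hodge_hodge] using h2) (by simpa [hodge_hodge] using h1)
    simpa [hodge_hodge] using h5
  have h0 : (-(1 / 4) * v) • (X 0).1 = 0 := by
    have e : (X 0).1 * (hodge (X 1)).1 * (Y 1).1 =
        (-(1 / 4) * v) • (X 0).1 + (Y 1).1 * ((hodge (X 0)).1 * (X 1).1) := by
      rw [Matrix.mul_assoc, h.hodge_mul_self, Matrix.mul_sub, Matrix.mul_smul, Matrix.mul_one,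
        ← Matrix.mul_assoc, h.mul_hodge_swap (by decide), Matrix.neg_mul, sub_neg_eq_add,
        Matrix.mul_assoc]
    rwa [h3, h4, Matrix.mul_zero, Matrix.zero_mul, add_zero, eq_comm] at e
  have h5 : X 0 = 0 := Subtype.ext ((smul_eq_zero.1 h0).resolve_left (by simpa using hv))
  have h6 := h.mixed 0 0
  rw [h5, map_zero, LinearMap.zero_apply, if_pos rfl] at h6
  exact hv h6.symm

/-- Wedging a linear relation between u and the f i with u gives a relation between the X i, and
pairing with the dual family Y kills its coefficients. -/
theorem IsHyperbolic.det4_ne_zero (hv : v ≠ 0) (h : IsHyperbolic X Y v) {u : Mink} (hu : u ≠ 0)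
    {f : Fin 3 → Mink} (hX : ∀ i, X i = wedge u (f i)) : det4 u (f 0) (f 1) (f 2) ≠ 0 := by
  intro hdet
  obtain ⟨c, hc0, hc⟩ := Matrix.exists_vecMul_eq_zero_iff.2 hdet
  have hc' : c 0 • u + c 1 • f 0 + c 2 • f 1 + c 3 • f 2 = 0 := by
    rw [← hc]
    ext I
    simp [Matrix.vecMul, dotProduct, Fin.sum_univ_four]
  have hsum : c 1 • X 0 + c 2 • X 1 + c 3 • X 2 = 0 := by
    have h1 := congrArg (wedge u) hc'
    simp only [wedge_add_right, wedge_smul_right, wedge_self, ← hX, smul_zero, zero_add] at h1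
    rw [h1, ← zero_smul ℝ u, wedge_smul_right, zero_smul]
  have h2 (i : Fin 3) := congrArg (fun Z => epsForm Z (Y i)) hsum
  simp only [map_add, map_smul, LinearMap.add_apply, LinearMap.smul_apply, h.mixed, map_zero,
    LinearMap.zero_apply, smul_eq_mul] at h2
  have c1 : c 1 = 0 := by simpa [hv] using h2 0
  have c2 : c 2 = 0 := by simpa [hv] using h2 1
  have c3 : c 3 = 0 := by simpa [hv] using h2 2
  have c0 : c 0 = 0 := by simpa [c1, c2, c3, hu] using hc'
  apply hc0
  ext I
  fin_cases I <;> simp [c0, c1, c2, c3]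

end

/-- The wedge products of a basis and those of the complementary pairs are dual for `epsForm`, up to
the factor −4 det. This is the resulting expansion, cleared of denominators. -/
theorem smul_eq_sum_wedge (b₀ b₁ b₂ b₃ : Mink) (Z : so31) :
    (-4 * det4 b₀ b₁ b₂ b₃) • Z =
      epsForm Z (wedge b₂ b₃) • wedge b₀ b₁ + epsForm Z (wedge b₃ b₁) • wedge b₀ b₂ +
      epsForm Z (wedge b₁ b₂) • wedge b₀ b₃ + epsForm Z (wedge b₀ b₁) • wedge b₂ b₃ +
      epsForm Z (wedge b₀ b₂) • wedge b₃ b₁ + epsForm Z (wedge b₀ b₃) • wedge b₁ b₂ := by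
  obtain ⟨a, b, c, d, f, g, rfl⟩ := exists_ofComps Z
  simp only [wedge_eq_ofComps, epsForm_ofComps, ofComps_smul, ofComps_add, det4_eq]
  congr 1 <;> ring

/-- With `epsForm_adapted`: on bivectors κ b ∧ c + u ∧ (…) and their cyclic versions, the form sees
only the symmetric part of the matrix of coefficients behind u. -/
theorem epsForm_adapted_self (κ x y z : ℝ) (u a b c : Mink) :
    epsForm (κ • wedge b c + wedge u (x • a + y • b + z • c))
      (κ • wedge b c + wedge u (x • a + y • b + z • c)) = -4 * det4 u a b c * κ * (2 * x) := by
  simp only [wedge_eq_ofComps, ofComps_smul, ofComps_add, epsForm_ofComps, det4_eq, Pi.add_apply,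
    Pi.smul_apply, smul_eq_mul]
  ring

theorem epsForm_adapted (κ x y z x' y' z' : ℝ) (u a b c : Mink) :
    epsForm (κ • wedge b c + wedge u (x • a + y • b + z • c))
      (κ • wedge c a + wedge u (x' • a + y' • b + z' • c)) =
        -4 * det4 u a b c * κ * (y + x') := by
  simp only [wedge_eq_ofComps, ofComps_smul, ofComps_add, epsForm_ofComps, det4_eq, Pi.add_apply,
    Pi.smul_apply, smul_eq_mul]
  ring

theorem det4_rotate (u a b c : Mink) : det4 u b c a = det4 u a b c := by
  simp only [det4_eq]
  ring

/-- Up to an overall sign, a hyperbolic family of bivectors whose first three members have a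
common vector consists of the wedge products of four vectors. -/
theorem IsHyperbolic.exists_wedge {X Y : Fin 3 → so31} {v : ℝ} (hv : v ≠ 0)
    (h : IsHyperbolic X Y v) {u : Mink} (hu : u ≠ 0) (hX : ∀ i, (hodge (X i)).1 *ᵥ u = 0) :
    ∃ (e : Fin 4 → Mink) (s : ℝ), (s = 1 ∨ s = -1) ∧
      X 0 = s • wedge (e 0) (e 1) ∧ X 1 = s • wedge (e 0) (e 2) ∧ X 2 = s • wedge (e 0) (e 3) ∧
      Y 0 = s • wedge (e 2) (e 3) ∧ Y 1 = s • wedge (e 3) (e 1) ∧ Y 2 = s • wedge (e 1) (e 2) := by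
  choose f hf using fun i => exists_eq_wedge_of_hodge_mulVec_eq_zero hu (hX i)
  have hD := h.det4_ne_zero hv hu hf
  set D := det4 u (f 0) (f 1) (f 2) with hDdef
  -- This κ gives κ f₁ ∧ f₂ the pairing v with X 0 = u ∧ f₀, and likewise cyclically. So Y i differs
  -- from such a term only by a bivector divisible by u.
  obtain ⟨κ, hκ⟩ : ∃ κ, -4 * D * κ = v := ⟨v / (-4 * D), by field_simp⟩
  have hκ0 : κ ≠ 0 := by
    rintro rfl
    exact hv (by rw [← hκ, mul_zero])
  have hD4 : -4 * D ≠ 0 := by simpa using hD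
  have hexp (i : Fin 3) : ∃ x y z : ℝ, Y i =
      κ • (![wedge (f 1) (f 2), wedge (f 2) (f 0), wedge (f 0) (f 1)] : Fin 3 → so31) i +
        wedge u (x • f 0 + y • f 1 + z • f 2) := by
    have h1 := smul_eq_sum_wedge u (f 0) (f 1) (f 2) (Y i)
    rw [← hf, ← hf, ← hf, epsForm_comm _ (X 0), epsForm_comm _ (X 1), epsForm_comm _ (X 2),
      h.mixed, h.mixed, h.mixed, ← hDdef] at h1
    refine ⟨epsForm (Y i) (wedge (f 1) (f 2)) / (-4 * D),
      epsForm (Y i) (wedge (f 2) (f 0)) / (-4 * D),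
      epsForm (Y i) (wedge (f 0) (f 1)) / (-4 * D), ?_⟩
    apply smul_right_injective _ hD4
    simp only [wedge_add_right, wedge_smul_right, smul_add, smul_smul, ← hf,
      mul_div_cancel₀ _ hD4, hκ]
    rw [h1]
    fin_cases i <;> simp <;> abel
  obtain ⟨x₀, y₀, z₀, h₀⟩ := hexp 0
  obtain ⟨x₁, y₁, z₁, h₁⟩ := hexp 1
  obtain ⟨x₂, y₂, z₂, h₂⟩ := hexp 2
  simp only [Matrix.cons_val] at h₀ h₁ h₂
  have hDκ : -4 * D * κ ≠ 0 := mul_ne_zero hD4 hκ0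
  have r₁ : det4 u (f 1) (f 2) (f 0) = D := det4_rotate ..
  have r₂ : det4 u (f 2) (f 0) (f 1) = D := by rw [← det4_rotate, hDdef]
  -- Summands are reordered cyclically here and below so that the same two identities cover all six
  -- pairs.
  replace h₁ : Y 1 = κ • wedge (f 2) (f 0) + wedge u (y₁ • f 1 + z₁ • f 2 + x₁ • f 0) := by
    rw [h₁]; congr 2; abel
  have e11 := h.right 1 1
  rw [h₁, epsForm_adapted_self, r₁] at e11
  have e12 := h.right 1 2
  replace h₂ : Y 2 = κ • wedge (f 0) (f 1) + wedge u (y₂ • f 1 + z₂ • f 2 + x₂ • f 0) := by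
    rw [h₂]; congr 2; abel
  rw [h₁, h₂, epsForm_adapted, r₁] at e12
  replace h₂ : Y 2 = κ • wedge (f 0) (f 1) + wedge u (z₂ • f 2 + x₂ • f 0 + y₂ • f 1) := by
    rw [h₂]; congr 2; abel
  have e22 := h.right 2 2
  rw [h₂, epsForm_adapted_self, r₂] at e22
  have e00 := h.right 0 0
  rw [h₀, epsForm_adapted_self] at e00
  have e20 := h.right 2 0
  replace h₀ : Y 0 = κ • wedge (f 1) (f 2) + wedge u (z₀ • f 2 + x₀ • f 0 + y₀ • f 1) := by
    rw [h₀]; congr 2; abel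
  rw [h₀, h₂, epsForm_adapted, r₂] at e20
  have e01 := h.right 0 1
  replace h₀ : Y 0 = κ • wedge (f 1) (f 2) + wedge u (x₀ • f 0 + y₀ • f 1 + z₀ • f 2) := by
    rw [h₀]; congr 2; abel
  replace h₁ : Y 1 = κ • wedge (f 2) (f 0) + wedge u (x₁ • f 0 + y₁ • f 1 + z₁ • f 2) := by
    rw [h₁]; congr 2; abel
  rw [h₀, h₁, epsForm_adapted] at e01
  obtain rfl : x₀ = 0 := by simpa using (mul_eq_zero.1 e00).resolve_left hDκ
  obtain rfl : y₁ = 0 := by simpa using (mul_eq_zero.1 e11).resolve_left hDκ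
  obtain rfl : z₂ = 0 := by simpa using (mul_eq_zero.1 e22).resolve_left hDκ
  have e01 : y₀ + x₁ = 0 := (mul_eq_zero.1 e01).resolve_left hDκ
  have e12 : z₁ + y₂ = 0 := (mul_eq_zero.1 e12).resolve_left hDκ
  have e20 : x₂ + z₀ = 0 := (mul_eq_zero.1 e20).resolve_left hDκ
  -- The coefficient matrix is now antisymmetric. Its three parameters are absorbed by the shifts f
  -- i + α i u, which do not change u ∧ f i.
  obtain ⟨g, hg, hY0, hY1, hY2⟩ : ∃ g : Fin 3 → Mink, (∀ i, X i = wedge u (g i)) ∧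
      Y 0 = κ • wedge (g 1) (g 2) ∧ Y 1 = κ • wedge (g 2) (g 0) ∧
      Y 2 = κ • wedge (g 0) (g 1) := by
    obtain ⟨α₀, rfl⟩ : ∃ α, y₂ = κ * α := ⟨y₂ / κ, by field_simp⟩
    obtain ⟨α₁, rfl⟩ : ∃ α, z₀ = κ * α := ⟨z₀ / κ, by field_simp⟩
    obtain ⟨α₂, rfl⟩ : ∃ α, x₁ = κ * α := ⟨x₁ / κ, by field_simp⟩
    obtain rfl := eq_neg_of_add_eq_zero_left e01
    obtain rfl := eq_neg_of_add_eq_zero_left e12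
    obtain rfl := eq_neg_of_add_eq_zero_left e20
    refine ⟨![f 0 + α₀ • u, f 1 + α₁ • u, f 2 + α₂ • u], fun i => ?_, ?_, ?_, ?_⟩
    · rw [hf]
      fin_cases i <;> simp [wedge_add_right, wedge_smul_right, wedge_self]
    all_goals
      simp only [h₀, h₁, h₂, Matrix.cons_val, wedge_eq_ofComps, ofComps_smul, ofComps_add,
        Pi.add_apply, Pi.smul_apply, smul_eq_mul]
      congr 1 <;> ring
  -- Rescaling u and the g i inversely by √|κ| normalises κ to its sign, which becomes the overall
  -- sign s.
  rcases hκ0.lt_or_gt with hneg | hpos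
  · have hs : √(-κ) ≠ 0 := (Real.sqrt_pos.2 (neg_pos.2 hneg)).ne'
    have hs2 : -(√(-κ) * √(-κ)) = κ := by rw [Real.mul_self_sqrt (neg_pos.2 hneg).le, neg_neg]
    refine ⟨![-(√(-κ))⁻¹ • u, √(-κ) • g 0, √(-κ) • g 1, √(-κ) • g 2], -1, .inr rfl, ?_⟩
    simp only [Matrix.cons_val, wedge_smul_left, wedge_smul_right, smul_smul, ← hg]
    simp [hs, hs2, hY0, hY1, hY2]
  · have hs : √κ ≠ 0 := (Real.sqrt_pos.2 hpos).ne'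
    have hs2 : √κ * √κ = κ := Real.mul_self_sqrt hpos.le
    refine ⟨![(√κ)⁻¹ • u, √κ • g 0, √κ • g 1, √κ • g 2], 1, .inl rfl, ?_⟩
    simp only [Matrix.cons_val, wedge_smul_left, wedge_smul_right, smul_smul, ← hg]
    simp [hs, hs2, hY0, hY1, hY2]

/-- The bivectors of a corner cell with nonzero volume are, up to an overall sign, the wedge
products of four vectors or the Hodge duals of such wedge products. -/
theorem exists_tetrad_of_epsForm {C : Fin 4 → Fin 4 → so31} {v : ℝ} (hv : v ≠ 0)
    (hC : ∀ i j, C j i = -C i j)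
    (h : ∀ i j k l, epsForm (C i j) (C k l) = levi ![i, j, k, l] * v) :
    ∃ (e : Fin 4 → Mink) (s : ℝ), (s = 1 ∨ s = -1) ∧
      ((∀ i j, C i j = s • hodge (wedge (e i) (e j))) ∨
        ∀ i j, C i j = s • wedge (e i) (e j)) := by
  have hC0 (i : Fin 4) : C i i = 0 := by
    have h1 := hC i i
    rw [eq_neg_iff_add_eq_zero, ← two_smul ℝ] at h1
    exact (smul_eq_zero.1 h1).resolve_left two_ne_zero
  have all {D : Fin 4 → Fin 4 → so31} (hD : ∀ i j, D j i = -D i j) (hD0 : ∀ i, D i i = 0)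
      {e : Fin 4 → Mink} {s : ℝ} (h01 : D 0 1 = s • wedge (e 0) (e 1))
      (h02 : D 0 2 = s • wedge (e 0) (e 2)) (h03 : D 0 3 = s • wedge (e 0) (e 3))
      (h23 : D 2 3 = s • wedge (e 2) (e 3)) (h31 : D 3 1 = s • wedge (e 3) (e 1))
      (h12 : D 1 2 = s • wedge (e 1) (e 2)) (i j : Fin 4) : D i j = s • wedge (e i) (e j) := by
    fin_cases i <;> fin_cases j <;>
      simp only [Fin.zero_eta, Fin.mk_one, Fin.reduceFinMk] <;>
      first
      | assumption
      | rw [hD0, wedge_self, smul_zero]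
      | rw [hD, wedge_swap, smul_neg, neg_inj]; assumption
  -- The wedges 01, 02, 03 are matched with the opposite wedges 23, 31, 12, ordered so that each
  -- pair has Levi-Civita sign +1.
  have hyp : IsHyperbolic (fun i => C 0 i.succ) (fun i => C (![2, 3, 1] i) (![3, 1, 2] i)) v := by
    constructor
    · intro i j
      have : ∀ i j : Fin 3, levi ![0, i.succ, 0, j.succ] = 0 := by decide
      rw [h, this, Int.cast_zero, zero_mul]
    · intro i j
      have : ∀ i j : Fin 3, levi ![![2, 3, 1] i, ![3, 1, 2] i, ![2, 3, 1] j,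
        (![3, 1, 2] j : Fin 4)] = 0 := by decide
      rw [h, this, Int.cast_zero, zero_mul]
    · intro i j
      have : ∀ i j : Fin 3, levi ![0, i.succ, ![2, 3, 1] j, ![3, 1, 2] j] =
        if i = j then 1 else 0 := by decide
      rw [h, this]
      split_ifs <;> simp
  rcases hyp.exists_mulVec_eq_zero hv with ⟨u, hu, hX⟩ | ⟨u, hu, hX⟩
  · obtain ⟨e, s, hs, h01, h02, h03, h23, h31, h12⟩ := hyp.exists_wedge hv hu hX
    exact ⟨e, s, hs, .inr (all hC hC0 h01 h02 h03 h23 h31 h12)⟩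
  · obtain ⟨e, s, hs, h01, h02, h03, h23, h31, h12⟩ :=
      hyp.map_hodge.exists_wedge (neg_ne_zero.2 hv) hu hX
    -- The sign changes because C is recovered from its dual as −∗∗C.
    refine ⟨e, -s, ?_, .inl fun i j => ?_⟩
    · rcases hs with rfl | rfl <;> simp
    · have h1 := all (D := fun i j => hodge (C i j)) (fun i j => by rw [hC, hodge_neg])
        (fun i => by rw [hC0, hodge_zero]) h01 h02 h03 h23 h31 h12 i j
      rw [neg_smul, ← hodge_smul, ← h1, hodge_hodge, neg_neg]

/-! ## The cubic form of a corner cell -/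

theorem levi_perm (σ : Equiv.Perm (Fin 4)) : levi σ = Equiv.Perm.sign σ := by
  revert σ
  decide

theorem levi_eq_zero {n : ℕ} {f : Fin n → Fin n} (hf : ¬f.Injective) : levi f = 0 := by
  obtain ⟨i, j, hij, hne⟩ := Function.not_injective_iff.1 hf
  wlog hlt : i < j generalizing i j
  · exact this j i hij.symm hne.symm (lt_of_le_of_ne (not_lt.1 hlt) hne.symm)
  refine Finset.prod_eq_zero (Finset.mem_univ i) (Finset.prod_eq_zero (Finset.mem_Ioi.2 hlt) ?_)
  rw [hij, sub_self, Int.sign_zero]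

theorem det_comp (e : Fin 4 → Mink) (f : Fin 4 → Fin 4) :
    (Matrix.of fun i => e (f i)).det = levi f * (Matrix.of e).det := by
  by_cases hf : f.Injective
  · have hb := Finite.injective_iff_bijective.1 hf
    have h := Matrix.det_permute (Equiv.ofBijective f hb) (Matrix.of e)
    rw [← levi_perm] at h
    exact h
  · obtain ⟨i, j, hij, hne⟩ := Function.not_injective_iff.1 hf
    rw [levi_eq_zero hf, Int.cast_zero, zero_mul]
    exact Matrix.det_zero_of_row_eq hne (by ext; simp [hij])

theorem det4_index (e : Fin 4 → Mink) (a b c d : Fin 4) :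
    det4 (e a) (e b) (e c) (e d) = levi ![a, b, c, d] * (Matrix.of e).det := by
  rw [← det_comp, det4]
  congr 2
  ext i
  fin_cases i <;> rfl

theorem levi_swap (a b c d : Fin 4) :
    levi ![b, a, c, d] = -levi ![a, b, c, d] ∧ levi ![a, c, b, d] = -levi ![a, b, c, d] ∧
      levi ![a, b, d, c] = -levi ![a, b, c, d] := by
  revert a b c d
  decide

/-- The contraction of a function of four indices with the Levi-Civita symbol. -/
def altSum (F : Fin 4 → Fin 4 → Fin 4 → Fin 4 → ℝ) : ℝ :=
  ∑ a, ∑ b, ∑ c, ∑ d, (levi ![a, b, c, d] : ℝ) * F a b c d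

theorem altSum_add (F G : Fin 4 → Fin 4 → Fin 4 → Fin 4 → ℝ) :
    altSum (fun a b c d => F a b c d + G a b c d) = altSum F + altSum G := by
  simp only [altSum, mul_add, Finset.sum_add_distrib]

theorem altSum_mul (r : ℝ) (F : Fin 4 → Fin 4 → Fin 4 → Fin 4 → ℝ) :
    altSum (fun a b c d => r * F a b c d) = r * altSum F := by
  simp only [altSum, Finset.mul_sum]
  refine Finset.sum_congr rfl fun a _ => Finset.sum_congr rfl fun b _ =>
    Finset.sum_congr rfl fun c _ => Finset.sum_congr rfl fun d _ => ?_
  ring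

theorem altSum_swap₁ (F : Fin 4 → Fin 4 → Fin 4 → Fin 4 → ℝ) :
    altSum (fun a b c d => F b a c d) = -altSum F := by
  rw [altSum, Finset.sum_comm]
  simp only [altSum, ← Finset.sum_neg_distrib]
  refine Finset.sum_congr rfl fun a _ => Finset.sum_congr rfl fun b _ =>
    Finset.sum_congr rfl fun c _ => Finset.sum_congr rfl fun d _ => ?_
  rw [(levi_swap a b c d).1]
  push_cast
  ring

theorem altSum_swap₂ (F : Fin 4 → Fin 4 → Fin 4 → Fin 4 → ℝ) :
    altSum (fun a b c d => F a c b d) = -altSum F := by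
  simp only [altSum, ← Finset.sum_neg_distrib]
  refine Finset.sum_congr rfl fun a _ => ?_
  rw [Finset.sum_comm]
  refine Finset.sum_congr rfl fun b _ =>
    Finset.sum_congr rfl fun c _ => Finset.sum_congr rfl fun d _ => ?_
  rw [(levi_swap a b c d).2.1]
  push_cast
  ring

theorem altSum_swap₃ (F : Fin 4 → Fin 4 → Fin 4 → Fin 4 → ℝ) :
    altSum (fun a b c d => F a b d c) = -altSum F := by
  simp only [altSum, ← Finset.sum_neg_distrib]
  refine Finset.sum_congr rfl fun a _ => Finset.sum_congr rfl fun b _ => ?_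
  rw [Finset.sum_comm]
  refine Finset.sum_congr rfl fun c _ => Finset.sum_congr rfl fun d _ => ?_
  rw [(levi_swap a b c d).2.2]
  push_cast
  ring

theorem altSum_swap₁₃ (F : Fin 4 → Fin 4 → Fin 4 → Fin 4 → ℝ) :
    altSum (fun a b c d => F c b a d) = -altSum F := by
  rw [altSum_swap₁ fun a b c d => F c a b d, altSum_swap₂ fun a b c d => F b a c d,
    altSum_swap₁ F, neg_neg]

theorem altSum_swap₁₄ (F : Fin 4 → Fin 4 → Fin 4 → Fin 4 → ℝ) :
    altSum (fun a b c d => F d b c a) = -altSum F := by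
  rw [altSum_swap₃ fun a b c d => F c b d a, altSum_swap₁₃ fun a b c d => F a b d c,
    altSum_swap₃ F, neg_neg]

theorem altSum_swap₂₄ (F : Fin 4 → Fin 4 → Fin 4 → Fin 4 → ℝ) :
    altSum (fun a b c d => F a d c b) = -altSum F := by
  rw [altSum_swap₃ fun a b c d => F a c d b, altSum_swap₂ fun a b c d => F a b d c,
    altSum_swap₃ F, neg_neg]

/-- The cubic form `ε^{abcd} tr ([C_{qa}, C_{bc}] C_{dr})` of a family of bivectors. -/
def cubicForm (C : Fin 4 → Fin 4 → so31) (q r : Fin 4) : ℝ :=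
  altSum fun a b c d => traceForm ⁅C q a, C b c⁆ (C d r)

/-- Every term of the trace contains a product of inner products that is symmetric in two of the
antisymmetrised indices a, b, c, d, so the contraction equals its own negative. -/
theorem cubicForm_wedge (e : Fin 4 → Mink) (q r : Fin 4) :
    cubicForm (fun i j => wedge (e i) (e j)) q r = 0 := by
  set m : Fin 4 → Fin 4 → ℝ := fun i j => mdot (e i) (e j) with hm
  have hs (i j : Fin 4) : m i j = m j i := mdot_comm _ _
  have z₁ : altSum (fun a b c d => m a b * (m c d * m q r - m q d * m c r)) = 0 := by
    refine self_eq_neg.1 (Eq.trans ?_ (altSum_swap₁ _))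
    simp only [hs]
  have z₂ : altSum (fun a b c d => m a c * (m b d * m q r - m q d * m b r)) = 0 := by
    refine self_eq_neg.1 (Eq.trans ?_ (altSum_swap₁₃ _))
    simp only [hs]
  have z₃ : altSum (fun a b c d => m q b * (m c d * m a r)) = 0 := by
    refine self_eq_neg.1 (Eq.trans ?_ (altSum_swap₃ _))
    simp only [hs]
  have z₄ : altSum (fun a b c d => m q b * (m a d * m c r)) = 0 := by
    refine self_eq_neg.1 (Eq.trans ?_ (altSum_swap₁₄ _))
    simp only [hs]
  have z₅ : altSum (fun a b c d => m q c * (m b d * m a r)) = 0 := by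
    refine self_eq_neg.1 (Eq.trans ?_ (altSum_swap₂₄ _))
    simp only [hs]
  have z₆ : altSum (fun a b c d => m q c * (m a d * m b r)) = 0 := by
    refine self_eq_neg.1 (Eq.trans ?_ (altSum_swap₁₄ _))
    simp only [hs]
  calc _ = altSum fun a b c d => 2 * (m a b * (m c d * m q r - m q d * m c r)) +
        (-2 * (m a c * (m b d * m q r - m q d * m b r)) +
        (-2 * (m q b * (m c d * m a r)) + (2 * (m q b * (m a d * m c r)) +
        (2 * (m q c * (m b d * m a r)) + -2 * (m q c * (m a d * m b r)))))) := by
        rw [cubicForm]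
        congr 1
        funext a b c d
        rw [traceForm_bracket_wedge]
        simp only [hm]
        ring
    _ = 0 := by
        simp only [altSum_add, altSum_mul, z₁, z₂, z₃, z₄, z₅, z₆, mul_zero, add_zero]

/-- Each determinant is a Levi-Civita symbol times det(e), and contracting two symbols in three
indices gives 3! times a Kronecker delta. -/
theorem altSum_mdot_det4 (e : Fin 4 → Mink) (q r : Fin 4) :
    altSum (fun a b c d => mdot (e q) (e b) * det4 (e a) (e c) (e d) (e r)) =
      6 * (Matrix.of e).det * mdot (e q) (e r) := by
  have h : ∀ b r : Fin 4, ∑ a, ∑ c, ∑ d, levi ![a, b, c, d] * levi ![a, c, d, r] =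
      if b = r then 6 else 0 := by decide
  have h' (b : Fin 4) : ∑ a, ∑ c, ∑ d, (levi ![a, b, c, d] : ℝ) * (levi ![a, c, d, r] : ℝ) =
      if b = r then 6 else 0 := by
    exact_mod_cast h b r
  calc _ = ∑ b, mdot (e q) (e b) * (Matrix.of e).det *
        ∑ a, ∑ c, ∑ d, (levi ![a, b, c, d] : ℝ) * (levi ![a, c, d, r] : ℝ) := by
        rw [altSum, Finset.sum_comm]
        simp only [Finset.mul_sum, det4_index]
        refine Finset.sum_congr rfl fun b _ => Finset.sum_congr rfl fun a _ =>
          Finset.sum_congr rfl fun c _ => Finset.sum_congr rfl fun d _ => ?_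
        ring
    _ = _ := by
        simp only [h', mul_ite, mul_zero, Finset.sum_ite_eq', Finset.mem_univ, if_true]
        ring

/-- Of the four terms of the trace, two vanish by symmetry. The other two agree after exchanging b
and c and together give (2 + 2) · 6 = 24. -/
theorem cubicForm_hodge_wedge (e : Fin 4 → Mink) (q r : Fin 4) :
    cubicForm (fun i j => hodge (wedge (e i) (e j))) q r =
      24 * (Matrix.of e).det * mdot (e q) (e r) := by
  set m : Fin 4 → Fin 4 → ℝ := fun i j => mdot (e i) (e j) with hm
  have hs (i j : Fin 4) : m i j = m j i := mdot_comm _ _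
  have z₁ : altSum (fun a b c d => m a b * det4 (e q) (e c) (e d) (e r)) = 0 := by
    refine self_eq_neg.1 (Eq.trans ?_ (altSum_swap₁ _))
    simp only [hs]
  have z₂ : altSum (fun a b c d => m a c * det4 (e q) (e b) (e d) (e r)) = 0 := by
    refine self_eq_neg.1 (Eq.trans ?_ (altSum_swap₁₃ _))
    simp only [hs]
  have z₃ := altSum_mdot_det4 e q r
  have z₄ := altSum_swap₂ fun a b c d => m q b * det4 (e a) (e c) (e d) (e r)
  calc _ = altSum fun a b c d => -2 * (m a b * det4 (e q) (e c) (e d) (e r)) +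
        (2 * (m a c * det4 (e q) (e b) (e d) (e r)) +
        (2 * (m q b * det4 (e a) (e c) (e d) (e r)) +
          -2 * (m q c * det4 (e a) (e b) (e d) (e r)))) := by
        rw [cubicForm]
        congr 1
        funext a b c d
        rw [traceForm_bracket_hodge_wedge]
        simp only [hm]
        ring
    _ = _ := by
        simp only [altSum_add, altSum_mul, z₁, z₂, z₄]
        rw [z₃]
        ring

/-- Odd degree is the point: this form detects the overall sign of B, which the quadratic condition
GG1 and the volume cannot see. -/
theorem cubicForm_smul (s : ℝ) (C : Fin 4 → Fin 4 → so31) (q r : Fin 4) :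
    cubicForm (fun i j => s • C i j) q r = s ^ 3 * cubicForm C q r := by
  rw [cubicForm, cubicForm, ← altSum_mul]
  simp only [smul_lie, lie_smul, map_smul, LinearMap.smul_apply, smul_eq_mul]
  congr 1
  funext a b c d
  ring

/-! ## Signature -/

theorem toQuadraticForm'_apply (M : Matrix (Fin 4) (Fin 4) ℝ) (x : Fin 4 → ℝ) :
    M.toQuadraticForm' x = x ⬝ᵥ M *ᵥ x := by
  simp [Matrix.toQuadraticForm', Matrix.toLinearMap₂'_apply']

theorem η_toQuadraticForm' :
    η.toQuadraticForm' = QuadraticMap.weightedSumSquares ℝ (![-1, 1, 1, 1] : Fin 4 → ℝ) := by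
  ext x
  rw [toQuadraticForm'_apply]
  simp [η, Fin.sum_univ_four, QuadraticMap.weightedSumSquares_apply, Matrix.mulVec_diagonal,
    dotProduct]

theorem gram_equivalent (e : Fin 4 → Mink) (he : (Matrix.of e).det ≠ 0) (κ : ℝ) :
    (Matrix.of fun a b => κ * mdot (e a) (e b)).toQuadraticForm'.Equivalent
      (QuadraticMap.weightedSumSquares ℝ (fun i => κ * (![-1, 1, 1, 1] : Fin 4 → ℝ) i)) := by
  have hu : IsUnit (Matrix.of e)ᵀ.det := by rwa [Matrix.det_transpose, isUnit_iff_ne_zero]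
  -- The isometry sends a coefficient vector to the corresponding linear combination of the frame
  -- vectors.
  refine ⟨⟨Matrix.toLinearEquiv' _ (Matrix.invertibleOfIsUnitDet _ hu), fun x => ?_⟩⟩
  rw [toQuadraticForm'_apply, QuadraticMap.weightedSumSquares_apply]
  simp [Matrix.toLinearEquiv', Matrix.mulVec, Matrix.vecMul, dotProduct, Fin.sum_univ_four, mdot_eq]
  ring

/-- A negative κ exchanges the three positive directions with the one negative direction, and κ = 0
leaves the zero form. -/
theorem signature_gram_iff (e : Fin 4 → Mink) (he : (Matrix.of e).det ≠ 0) (κ : ℝ) :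
    (sigPos (Matrix.of fun a b => κ * mdot (e a) (e b)).toQuadraticForm' =
        sigPos η.toQuadraticForm' ∧
      sigNeg (Matrix.of fun a b => κ * mdot (e a) (e b)).toQuadraticForm' =
        sigNeg η.toQuadraticForm') ↔ 0 < κ := by
  rw [(gram_equivalent e he κ).sigPos_eq, (gram_equivalent e he κ).sigNeg_eq, η_toQuadraticForm']
  simp only [QuadraticForm.sigPos_weightedSumSquares, QuadraticForm.sigNeg_weightedSumSquares,
    Set.ncard_eq_toFinset_card', Set.toFinset_ofPred, Finset.card_filter, Fin.sum_univ_four]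
  rcases lt_trichotomy κ 0 with h | rfl | h
  · simp [h, not_lt.2 h.le]
  · simp
  · simp [h, not_lt.2 h.le, show ¬(1 : ℝ) < 0 by norm_num]

variable {V : Type*} {X : OrientedComplex V}

/-! ## Corner cells -/

/-- Moving P from the last place to its natural place takes 4 − P transpositions. -/
theorem levi_succAbove (P : Fin 5) (a b c d : Fin 4) :
    levi ![P.succAbove a, P.succAbove b, P.succAbove c, P.succAbove d, P] =
      (-1) ^ (P : ℕ) * levi ![a, b, c, d] := by
  revert P a b c d
  decide

theorem sgn4_succAbove (P : Fin 5) (a b c d : Fin 4) :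
    sgn4 (P.succAbove a) (P.succAbove b) (P.succAbove c) (P.succAbove d) =
      (-1) ^ (P : ℕ) * levi ![a, b, c, d] := by
  have h (i j : Fin 5) (hij : i ≠ j) (f : Fin 5 → Fin 5) (hf : f i = f j) : levi f = 0 :=
    levi_eq_zero fun hi => hij (hi hf)
  rw [sgn4, Fin.sum_univ_succAbove _ P, levi_succAbove, Finset.sum_eq_zero, add_zero]
  intro T _
  by_cases hi : (![a, b, c, d] : Fin 4 → Fin 4).Injective
  · obtain ⟨i, hiT⟩ := (Finite.injective_iff_surjective.1 hi) T
    refine h i.castSucc (Fin.last 4) (Fin.castSucc_lt_last i).ne _ ?_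
    rw [← hiT]
    fin_cases i <;> rfl
  · obtain ⟨i, j, hij, hne⟩ := Function.not_injective_iff.1 hi
    refine h i.castSucc j.castSucc (by simpa using hne) _ ?_
    have e (i : Fin 4) : (![P.succAbove a, P.succAbove b, P.succAbove c, P.succAbove d,
        P.succAbove T] : Fin 5 → Fin 5) i.castSucc =
        P.succAbove ((![a, b, c, d] : Fin 4 → Fin 4) i) := by
      fin_cases i <;> rfl
    rw [e, e, hij]

theorem neg_one_pow_mul_self (P : Fin 5) : (-1 : ℝ) ^ (P : ℕ) * (-1) ^ (P : ℕ) = 1 := by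
  rw [← mul_pow]
  simp

theorem BField.comp_of_ne (B : BField X) (ν : X.Atom) (s : OWedge) :
    B.comp ν s.1.1 s.1.2 = B.val ν s := dif_pos s.2

theorem BField.comp_self (B : BField X) (ν : X.Atom) (P : Fin 5) : B.comp ν P P = 0 :=
  dif_neg fun h => h rfl

theorem BField.comp_swap (B : BField X) (ν : X.Atom) (P Q : Fin 5) :
    B.comp ν Q P = -B.comp ν P Q := by
  rcases eq_or_ne P Q with rfl | h
  · rw [B.comp_self, neg_zero]
  · rw [BField.comp, BField.comp, dif_pos h, dif_pos h.symm]
    exact B.reverse ν ⟨(P, Q), h⟩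

theorem BField.ofTetrad_comp (e : Tetrad X) (ν : X.Atom) (P Q : Fin 5) :
    (BField.ofTetrad e).comp ν P Q = hodge (wedge (e ν P) (e ν Q)) := by
  rcases eq_or_ne P Q with rfl | h
  · rw [BField.comp_self, wedge_self, hodge_zero]
  · exact dif_pos h

/-- The bivectors of the corner cell of `P`, indexed by pairs of its four lines. -/
def BField.cell (B : BField X) (ν : X.Atom) (P : Fin 5) (i j : Fin 4) : so31 :=
  B.comp ν (P.succAbove i) (P.succAbove j)

theorem BField.cell_swap (B : BField X) (ν : X.Atom) (P : Fin 5) (i j : Fin 4) :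
    B.cell ν P j i = -B.cell ν P i j := B.comp_swap ..

/-- The four vectors of the corner cell of `P`, as the rows of a matrix. -/
def cellFrame (e : Tetrad X) (ν : X.Atom) (P : Fin 5) : Matrix (Fin 4) (Fin 4) ℝ :=
  Matrix.of fun i => e ν (P.succAbove i)

/-- GG1 speaks of pairs of distinct lines only. The convention B_{QQ} = 0 extends it to all indices,
and the orientation sign of the cell is moved into the constant. -/
theorem GG1.epsForm_cell {B : BField X} {ν : X.Atom} {P : Fin 5} (h : GG1 B ν P)
    (i j k l : Fin 4) : epsForm (B.cell ν P i j) (B.cell ν P k l) =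
      levi ![i, j, k, l] * ((-1) ^ (P : ℕ) * (1 / 12 * pairSum B ν P)) := by
  rcases eq_or_ne i j with rfl | hij
  · have : levi ![i, i, k, l] = 0 := levi_eq_zero fun hi => by simpa using @hi 0 1 rfl
    rw [this, BField.cell, B.comp_self, map_zero, LinearMap.zero_apply, Int.cast_zero, zero_mul]
  rcases eq_or_ne k l with rfl | hkl
  · have : levi ![i, j, k, k] = 0 := levi_eq_zero fun hi => by simpa using @hi 2 3 rfl
    rw [this, BField.cell, BField.cell, B.comp_self ν (P.succAbove k), map_zero, Int.cast_zero,
      zero_mul]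
  have h1 := h ⟨(P.succAbove i, P.succAbove j), by simpa using hij⟩
    ⟨(P.succAbove k, P.succAbove l), by simpa using hkl⟩
    ⟨Fin.succAbove_ne _ _, Fin.succAbove_ne _ _⟩ ⟨Fin.succAbove_ne _ _, Fin.succAbove_ne _ _⟩
  rw [sub_eq_zero, sgnSS, sgn4_succAbove, epsPair_eq_epsForm, ← B.comp_of_ne, ← B.comp_of_ne] at h1
  rw [BField.cell, BField.cell, h1]
  push_cast
  ring

theorem sum_inCell (P : Fin 5) (F : Fin 5 → Fin 5 → ℝ) (hF : ∀ Q, F Q Q = 0) :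
    (∑ s : OWedge, if s.InCell P then F s.1.1 s.1.2 else 0) =
      ∑ i, ∑ j, F (P.succAbove i) (P.succAbove j) := by
  have h := sum_lines_eq_sum_wedges (fun Q R => if Q ≠ P ∧ R ≠ P then F Q R else 0)
    (by intro Q; simp [hF])
  refine h.symm.trans ?_
  simp [Fin.sum_univ_succAbove _ P]

theorem sum_levi_sq : ∑ a : Fin 4, ∑ b : Fin 4, ∑ c : Fin 4, ∑ d : Fin 4,
    (levi ![a, b, c, d] : ℝ) * (levi ![a, b, c, d] : ℝ) = 24 := by
  have h : ∑ a : Fin 4, ∑ b : Fin 4, ∑ c : Fin 4, ∑ d : Fin 4,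
      levi ![a, b, c, d] * levi ![a, b, c, d] = 24 := by decide
  exact_mod_cast h

theorem pairSum_eq (B : BField X) (ν : X.Atom) (P : Fin 5) : pairSum B ν P =
    1 / 2 * ∑ i, ∑ j, ∑ k, ∑ l, (-1) ^ (P : ℕ) * levi ![i, j, k, l] *
      epsForm (B.cell ν P i j) (B.cell ν P k l) := by
  have h1 (Q R : Fin 5) := sum_inCell P
    (fun S T => (sgn4 Q R S T : ℝ) * epsForm (B.comp ν Q R) (B.comp ν S T))
    (by intro S; rw [B.comp_self, map_zero, mul_zero])
  have h2 := sum_inCell P (fun Q R => ∑ s' : OWedge, if s'.InCell P then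
      (sgn4 Q R s'.1.1 s'.1.2 : ℝ) * epsForm (B.comp ν Q R) (B.comp ν s'.1.1 s'.1.2) else 0)
    (by intro S; simp [B.comp_self])
  rw [pairSum]
  congr 1
  calc _ = ∑ s : OWedge, if s.InCell P then ∑ s' : OWedge, if s'.InCell P then
        (sgn4 s.1.1 s.1.2 s'.1.1 s'.1.2 : ℝ) *
          epsForm (B.comp ν s.1.1 s.1.2) (B.comp ν s'.1.1 s'.1.2) else 0 else 0 := by
        refine Finset.sum_congr rfl fun s _ => ?_
        by_cases hs : s.InCell P
        · simp only [hs, true_and, if_true, B.comp_of_ne]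
          rfl
        · simp only [hs, false_and, if_false, Finset.sum_const_zero]
    _ = _ := by
        rw [h2]
        simp only [h1, sgn4_succAbove]
        push_cast
        rfl

/-- The factor 12 is half the number of permutations of four lines. -/
theorem pairSum_of_epsForm_cell {B : BField X} {ν : X.Atom} {P : Fin 5} {v : ℝ}
    (h : ∀ i j k l, epsForm (B.cell ν P i j) (B.cell ν P k l) = levi ![i, j, k, l] * v) :
    pairSum B ν P = 12 * ((-1) ^ (P : ℕ) * v) := by
  calc pairSum B ν P = 1 / 2 * ((∑ i : Fin 4, ∑ j : Fin 4, ∑ k : Fin 4, ∑ l : Fin 4,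
        (levi ![i, j, k, l] : ℝ) * (levi ![i, j, k, l] : ℝ)) * ((-1) ^ (P : ℕ) * v)) := by
        rw [pairSum_eq]
        simp only [h, Finset.sum_mul]
        congr 1
        refine Finset.sum_congr rfl fun a _ => Finset.sum_congr rfl fun b _ =>
          Finset.sum_congr rfl fun c _ => Finset.sum_congr rfl fun d _ => ?_
        ring
    _ = _ := by
        rw [sum_levi_sq]
        ring

theorem GG1_of_epsForm_cell {B : BField X} {ν : X.Atom} {P : Fin 5} {v : ℝ}
    (h : ∀ i j k l, epsForm (B.cell ν P i j) (B.cell ν P k l) = levi ![i, j, k, l] * v) :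
    GG1 B ν P := by
  intro s s' hs hs'
  obtain ⟨i, hi⟩ := Fin.exists_succAbove_eq hs.1
  obtain ⟨j, hj⟩ := Fin.exists_succAbove_eq hs.2
  obtain ⟨k, hk⟩ := Fin.exists_succAbove_eq hs'.1
  obtain ⟨l, hl⟩ := Fin.exists_succAbove_eq hs'.2
  have h1 := h i j k l
  rw [BField.cell, BField.cell, hi, hj, hk, hl, B.comp_of_ne, B.comp_of_ne] at h1
  rw [pairSum_of_epsForm_cell h, epsPair_eq_epsForm, h1, sgnSS, ← hi, ← hj, ← hk, ← hl,
    sgn4_succAbove]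
  push_cast
  linear_combination (-(levi ![i, j, k, l] : ℝ) * v) * neg_one_pow_mul_self P

theorem epsForm_cell_ofTetrad (e : Tetrad X) (ν : X.Atom) (P : Fin 5) (i j k l : Fin 4) :
    epsForm ((BField.ofTetrad e).cell ν P i j) ((BField.ofTetrad e).cell ν P k l) =
      levi ![i, j, k, l] * (4 * (cellFrame e ν P).det) := by
  rw [BField.cell, BField.cell, BField.ofTetrad_comp, BField.ofTetrad_comp, epsForm_hodge_hodge,
    epsForm_wedge_wedge, det4_index fun i => e ν (P.succAbove i), cellFrame]
  ring

theorem GG1_ofTetrad (e : Tetrad X) (ν : X.Atom) (P : Fin 5) : GG1 (BField.ofTetrad e) ν P :=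
  GG1_of_epsForm_cell (epsForm_cell_ofTetrad e ν P)

theorem volume_ofTetrad (e : Tetrad X) (ν : X.Atom) (P : Fin 5) :
    volume (BField.ofTetrad e) ν P = 4 ^ 5 * ((-1) ^ (P : ℕ) * (cellFrame e ν P).det) := by
  rw [volume, pairSum_of_epsForm_cell (epsForm_cell_ofTetrad e ν P)]
  ring

theorem nondegAt_iff (e : Tetrad X) (ν : X.Atom) (P : Fin 5) :
    NondegAt e ν P ↔ (cellFrame e ν P).det ≠ 0 := by
  have h : LinearIndependent ℝ (fun Q : {Q : Fin 5 // Q ≠ P} => e ν Q.1) ↔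
      (cellFrame e ν P).det ≠ 0 := by
    rw [← isUnit_iff_ne_zero, ← Matrix.isUnit_iff_isUnit_det,
      ← Matrix.linearIndependent_rows_iff_isUnit,
      ← linearIndependent_equiv (finSuccAboveEquiv P)]
    rfl
  refine ⟨fun hn => h.1 hn.1, fun hd => ⟨h.2 hd, ?_⟩⟩
  exact (h.2 hd).span_eq_top_of_card_eq_finrank' (by simp)

/-- All positively oriented orderings of the lines give the same determinant, namely that of the
increasing ordering times the orientation sign of the cell. -/
theorem posAt_iff (e : Tetrad X) (ν : X.Atom) (P : Fin 5) :
    PosAt e ν P ↔ 0 < (-1) ^ (P : ℕ) * (cellFrame e ν P).det := by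
  have key (i j k l : Fin 4) : (Matrix.of ![e ν (P.succAbove i), e ν (P.succAbove j),
      e ν (P.succAbove k), e ν (P.succAbove l)]).det =
      levi ![i, j, k, l] * (cellFrame e ν P).det :=
    det4_index (fun i => e ν (P.succAbove i)) i j k l
  constructor
  · intro h
    obtain ⟨i, j, k, l, hl⟩ : ∃ i j k l : Fin 4, levi ![i, j, k, l] = (-1) ^ (P : ℕ) := by
      have : ∀ P : Fin 5, ∃ i j k l : Fin 4, levi ![i, j, k, l] = (-1) ^ (P : ℕ) := by decide
      exact this P
    have h1 := h _ _ _ _ ((levi_succAbove P i j k l).trans (by rw [hl, ← mul_pow]; simp))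
    rw [key, hl] at h1
    exact_mod_cast h1
  · intro h a b c d habcd
    have hne (i : Fin 4) : (![a, b, c, d, P] : Fin 5 → Fin 5) i.castSucc ≠ P := by
      intro hi
      have h0 : levi ![a, b, c, d, P] = 0 := by
        refine levi_eq_zero fun hinj => (Fin.castSucc_lt_last i).ne (hinj ?_)
        rw [hi]
        rfl
      omega
    obtain ⟨i, rfl⟩ := Fin.exists_succAbove_eq (hne 0)
    obtain ⟨j, rfl⟩ := Fin.exists_succAbove_eq (hne 1)
    obtain ⟨k, rfl⟩ := Fin.exists_succAbove_eq (hne 2)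
    obtain ⟨l, rfl⟩ := Fin.exists_succAbove_eq (hne 3)
    rw [key]
    rw [levi_succAbove] at habcd
    have h1 : (-1 : ℝ) ^ (P : ℕ) * levi ![i, j, k, l] = 1 := by exact_mod_cast habcd
    have h2 : (levi ![i, j, k, l] : ℝ) = (-1) ^ (P : ℕ) := by
      linear_combination (-1 : ℝ) ^ (P : ℕ) * h1 -
        (levi ![i, j, k, l] : ℝ) * neg_one_pow_mul_self P
    rwa [h2]

theorem GG2_ofTetrad_iff (e : Tetrad X) (ν : X.Atom) (P : Fin 5) :
    GG2 (BField.ofTetrad e) ν P ↔ PosAt e ν P := by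
  rw [GG2, volume_ofTetrad, posAt_iff]
  simp

theorem volume_ofTetrad_ne_zero_iff (e : Tetrad X) (ν : X.Atom) (P : Fin 5) :
    volume (BField.ofTetrad e) ν P ≠ 0 ↔ NondegAt e ν P := by
  rw [volume_ofTetrad, nondegAt_iff]
  simp

/-! ## The metric of a corner cell -/

section CellMetric

variable {ι : Type*} [Fintype ι] (T : Module.Basis ι ℝ so31)

theorem structConst_eq (i j k : ι) : structConst T i j k = traceForm ⁅T i, T j⁆ (T k) := by
  conv_rhs => rw [← T.sum_repr ⁅T i, T j⁆]
  simp only [structConst, map_sum, map_smul, LinearMap.sum_apply, LinearMap.smul_apply, smul_eq_mul]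

/-- The contraction with structure constants does not depend on the basis, so the cell metric
reduces to `cubicForm`. -/
theorem sum_structConst (A B C : so31) :
    ∑ i, ∑ j, ∑ k, structConst T i j k * upperComp T A i * upperComp T B j * upperComp T C k =
      traceForm ⁅A, B⁆ C := by
  conv_rhs => rw [← T.sum_repr A, ← T.sum_repr B, ← T.sum_repr C]
  simp only [sum_lie, lie_sum, map_sum, LinearMap.sum_apply, smul_lie, lie_smul,
    map_smul, LinearMap.smul_apply, smul_eq_mul, structConst_eq, upperComp,
    Finset.mul_sum]
  rw [Finset.sum_comm]
  conv_rhs => rw [Finset.sum_comm]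
  refine Finset.sum_congr rfl fun j _ => ?_
  rw [Finset.sum_comm]
  refine Finset.sum_congr rfl fun k _ => Finset.sum_congr rfl fun i _ => ?_
  ring

theorem sum_comm_four {ι κ : Type*} [Fintype ι] [Fintype κ] (F : ι → κ → κ → κ → κ → ℝ) :
    ∑ i, ∑ a, ∑ b, ∑ c, ∑ d, F i a b c d = ∑ a, ∑ b, ∑ c, ∑ d, ∑ i, F i a b c d := by
  rw [Finset.sum_comm]
  refine Finset.sum_congr rfl fun a _ => ?_
  rw [Finset.sum_comm]
  refine Finset.sum_congr rfl fun b _ => ?_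
  rw [Finset.sum_comm]
  exact Finset.sum_congr rfl fun c _ => Finset.sum_comm

theorem sum_levi_five (P : Fin 5) (F : Fin 5 → Fin 5 → Fin 5 → Fin 5 → ℝ) :
    ∑ a, ∑ b, ∑ c, ∑ d, (levi ![a, b, c, d, P] : ℝ) * F a b c d =
      (-1) ^ (P : ℕ) * altSum fun a b c d =>
        F (P.succAbove a) (P.succAbove b) (P.succAbove c) (P.succAbove d) := by
  have h (i : Fin 4) (f : Fin 5 → Fin 5) (hf : f i.castSucc = f (Fin.last 4)) : levi f = 0 :=
    levi_eq_zero fun hi => (Fin.castSucc_lt_last i).ne (hi hf)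
  have h0 (b c d : Fin 5) : levi ![P, b, c, d, P] = 0 := h 0 _ rfl
  have h1 (a c d : Fin 5) : levi ![a, P, c, d, P] = 0 := h 1 _ rfl
  have h2 (a b d : Fin 5) : levi ![a, b, P, d, P] = 0 := h 2 _ rfl
  have h3 (a b c : Fin 5) : levi ![a, b, c, P, P] = 0 := h 3 _ rfl
  simp only [Fin.sum_univ_succAbove _ P, h0, h1, h2, h3, levi_succAbove, Int.cast_zero, zero_mul,
    Finset.sum_const_zero, zero_add, altSum, Finset.mul_sum]
  push_cast
  simp only [mul_assoc]

theorem cellMetric_succAbove (B : BField X) (ν : X.Atom) (P : Fin 5) (q r : Fin 4) :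
    cellMetric T B ν P (P.succAbove q) (P.succAbove r) =
      1 / (12 * volume B ν P) * ((-1) ^ (P : ℕ) * cubicForm (B.cell ν P) q r) := by
  rw [cellMetric]
  congr 1
  simp only [sum_comm_four]
  calc _ = ∑ a, ∑ b, ∑ c, ∑ d, (levi ![a, b, c, d, P] : ℝ) *
        ∑ i, ∑ j, ∑ k, structConst T i j k * upperComp T (B.comp ν (P.succAbove q) a) i *
          upperComp T (B.comp ν b c) j * upperComp T (B.comp ν d (P.succAbove r)) k := by
        refine Finset.sum_congr rfl fun a _ => Finset.sum_congr rfl fun b _ =>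
          Finset.sum_congr rfl fun c _ => Finset.sum_congr rfl fun d _ => ?_
        simp only [Finset.mul_sum]
        refine Finset.sum_congr rfl fun i _ => Finset.sum_congr rfl fun j _ =>
          Finset.sum_congr rfl fun k _ => ?_
        ring
    _ = _ := by
        simp only [sum_structConst]
        exact sum_levi_five P _

theorem cellMetricMatrix_eq {B : BField X} {ν : X.Atom} {P : Fin 5} {κ : ℝ} {e : Fin 4 → Mink}
    (h : ∀ q r, (-1) ^ (P : ℕ) * cubicForm (B.cell ν P) q r =
      12 * volume B ν P * (κ * mdot (e q) (e r))) (hv : volume B ν P ≠ 0) :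
    cellMetricMatrix T B ν P = Matrix.of fun a b => κ * mdot (e a) (e b) := by
  ext q r
  rw [cellMetricMatrix, Matrix.of_apply, cellMetric_succAbove, h, Matrix.of_apply]
  field_simp

/-- The bivectors of a corner cell with nonzero volume that satisfies GG1 and GG3 are the duals of
the wedge products of the vectors of a basis. -/
theorem GG1.exists_cell_eq {B : BField X} {ν : X.Atom} {P : Fin 5} (h1 : GG1 B ν P)
    (hv : volume B ν P ≠ 0) (h3 : GG3 T B ν P) :
    ∃ e : Fin 4 → Mink, (Matrix.of e).det ≠ 0 ∧
      ∀ i j, B.cell ν P i j = hodge (wedge (e i) (e j)) := by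
  set v := (-1) ^ (P : ℕ) * (1 / 12 * pairSum B ν P) with hvdef
  have hvol : volume B ν P = 4 ^ 4 * ((-1) ^ (P : ℕ) * v) := by
    rw [volume, hvdef, ← mul_assoc ((-1) ^ (P : ℕ)), neg_one_pow_mul_self, one_mul]
  have hv0 : v ≠ 0 := by
    intro h0
    rw [hvol, h0, mul_zero, mul_zero] at hv
    exact hv rfl
  obtain ⟨e, s, hs, he⟩ := exists_tetrad_of_epsForm hv0 (fun i j => B.cell_swap ν P i j)
    h1.epsForm_cell
  have hs2 : s * s = 1 := by rcases hs with rfl | rfl <;> norm_num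
  have hl : levi (![0, 1, 2, 3] : Fin 4 → Fin 4) = 1 := by decide
  have hv1 := h1.epsForm_cell 0 1 2 3
  rw [← hvdef, hl, Int.cast_one, one_mul] at hv1
  rcases he with he | he
  · have hdet : v = 4 * (Matrix.of e).det := by
      rw [← hv1, he, he]
      simp only [map_smul, LinearMap.smul_apply, epsForm_hodge_hodge, epsForm_wedge_wedge,
        det4_index, hl, smul_eq_mul]
      push_cast
      linear_combination 4 * (Matrix.of e).det * hs2
    have hdet0 : (Matrix.of e).det ≠ 0 := by
      intro h0
      rw [h0, mul_zero] at hdet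
      exact hv0 hdet
    refine ⟨e, hdet0, ?_⟩
    -- The constant is 24 s³ / (12 · 4⁴ · 4), with s³ = s and volume ±4⁵ det(e).
    have hM := cellMetricMatrix_eq T (B := B) (ν := ν) (P := P) (κ := s / 512) (e := e) (by
      intro q r
      rw [show B.cell ν P = fun i j => s • hodge (wedge (e i) (e j)) from
        funext fun i => funext fun j => he i j, cubicForm_smul, cubicForm_hodge_wedge, hvol, hdet]
      linear_combination (-1) ^ (P : ℕ) * 24 * s * (Matrix.of e).det * mdot (e q) (e r) * hs2) hv
    rw [GG3, hM, signature_gram_iff e hdet0] at h3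
    obtain rfl : s = 1 := hs.resolve_right (by rintro rfl; norm_num at h3)
    simpa using he
  · exfalso
    have hdet : v = -4 * (Matrix.of e).det := by
      rw [← hv1, he, he]
      simp only [map_smul, LinearMap.smul_apply, epsForm_wedge_wedge,
        det4_index, hl, smul_eq_mul]
      push_cast
      linear_combination -4 * (Matrix.of e).det * hs2
    have hdet0 : (Matrix.of e).det ≠ 0 := by
      intro h0
      rw [h0, mul_zero] at hdet
      exact hv0 hdet
    -- In the undualised sector the metric is identically zero, which GG3 excludes.
    have hM := cellMetricMatrix_eq T (B := B) (ν := ν) (P := P) (κ := 0) (e := e) (by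
      intro q r
      rw [show B.cell ν P = fun i j => s • wedge (e i) (e j) from
        funext fun i => funext fun j => he i j, cubicForm_smul, cubicForm_wedge]
      ring) hv
    rw [GG3, hM, signature_gram_iff e hdet0] at h3
    exact lt_irrefl _ h3

theorem GG3_ofTetrad (e : Tetrad X) (ν : X.Atom) (P : Fin 5) (h : NondegAt e ν P) :
    GG3 T (BField.ofTetrad e) ν P := by
  have hdet := (nondegAt_iff e ν P).1 h
  have hM := cellMetricMatrix_eq T (B := BField.ofTetrad e) (ν := ν) (P := P) (κ := 1 / 512)
    (e := fun i => e ν (P.succAbove i)) (by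
      intro q r
      rw [show (BField.ofTetrad e).cell ν P = fun i j =>
        hodge (wedge (e ν (P.succAbove i)) (e ν (P.succAbove j))) from
        funext fun i => funext fun j => BField.ofTetrad_comp .., cubicForm_hodge_wedge
          (fun i => e ν (P.succAbove i)), volume_ofTetrad, cellFrame]
      ring) ((volume_ofTetrad_ne_zero_iff e ν P).2 h)
  rw [GG3, hM, signature_gram_iff _ hdet]
  norm_num

end CellMetric

/-! ## Gluing the corner cells of a 4-simplex -/

/-- Cramer's rule without division. -/
theorem det4_smul_eq (a b c d p : Mink) : det4 a b c d • p =
    det4 p b c d • a + det4 a p c d • b + det4 a b p d • c + det4 a b c p • d := by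
  ext I
  simp only [Pi.add_apply, Pi.smul_apply, smul_eq_mul, det4_eq]
  fin_cases I <;> simp <;> ring

/-- The hypotheses put p in the plane of a and b and in the plane of a and c, which meet in the line
of a. -/
theorem exists_eq_smul {a b c d p : Mink} (hD : det4 a b c d ≠ 0)
    (h1 : ∀ x, epsForm (wedge p x) (wedge a b) = 0)
    (h2 : ∀ x, epsForm (wedge p x) (wedge a c) = 0) : ∃ t : ℝ, p = t • a := by
  simp only [epsForm_wedge_wedge, mul_eq_zero, neg_eq_zero, OfNat.ofNat_ne_zero, false_or] at h1 h2
  have e1 : det4 a p c d = 0 := by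
    rw [← neg_eq_zero, ← h2 d]
    simp only [det4_eq]
    ring
  have e2 : det4 a b p d = 0 := by
    rw [← h1 d]
    simp only [det4_eq]
    ring
  have e3 : det4 a b c p = 0 := by
    rw [← neg_eq_zero, ← h1 c]
    simp only [det4_eq]
    ring
  have h := det4_smul_eq a b c d p
  rw [e1, e2, e3, zero_smul, zero_smul, zero_smul, add_zero, add_zero, add_zero] at h
  refine ⟨(det4 a b c d)⁻¹ * det4 p b c d, ?_⟩
  rw [mul_smul, ← h, inv_smul_smul₀ hD]

theorem wedge_ne_zero {a b c d : Mink} (hD : det4 a b c d ≠ 0) : wedge a b ≠ 0 := by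
  intro h
  have h1 := epsForm_wedge_wedge a b c d
  rw [h, map_zero, LinearMap.zero_apply] at h1
  exact hD (by linarith)

theorem det4_permutations (a b c d : Mink) : det4 a c b d = -det4 a b c d ∧
    det4 b c a d = det4 a b c d ∧ det4 b a c d = -det4 a b c d ∧ det4 c a b d = det4 a b c d ∧
    det4 a b d c = -det4 a b c d := by
  simp only [det4_eq]
  refine ⟨?_, ?_, ?_, ?_, ?_⟩ <;> ring

theorem epsForm_wedge_eq_zero_left (a b x : Mink) : epsForm (wedge a x) (wedge a b) = 0 := by
  simp only [epsForm_wedge_wedge, det4_eq]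
  ring

/-- Three linearly independent vectors are determined by their wedge products up to a common
sign. -/
theorem exists_sign {a b c d a' b' c' : Mink} (hD : det4 a b c d ≠ 0)
    (hab : wedge a' b' = wedge a b) (hac : wedge a' c' = wedge a c)
    (hbc : wedge b' c' = wedge b c) :
    ∃ s : ℝ, s * s = 1 ∧ a' = s • a ∧ b' = s • b ∧ c' = s • c := by
  obtain ⟨p₁, p₂, p₃, p₄, p₅⟩ := det4_permutations a b c d
  have hba : wedge b' a' = wedge b a := by rw [wedge_swap a', wedge_swap a, hab]
  have hca : wedge c' a' = wedge c a := by rw [wedge_swap a', wedge_swap a, hac]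
  have hcb : wedge c' b' = wedge c b := by rw [wedge_swap b', wedge_swap b, hbc]
  obtain ⟨x, hx⟩ : ∃ t : ℝ, a' = t • a := exists_eq_smul hD
    (fun y => by rw [← hab, epsForm_wedge_eq_zero_left])
    (fun y => by rw [← hac, epsForm_wedge_eq_zero_left])
  obtain ⟨y, hy⟩ : ∃ t : ℝ, b' = t • b := exists_eq_smul (by rwa [p₂])
    (fun y => by rw [← hbc, epsForm_wedge_eq_zero_left])
    (fun y => by rw [← hba, epsForm_wedge_eq_zero_left])
  obtain ⟨z, hz⟩ : ∃ t : ℝ, c' = t • c := exists_eq_smul (by rwa [p₄])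
    (fun y => by rw [← hca, epsForm_wedge_eq_zero_left])
    (fun y => by rw [← hcb, epsForm_wedge_eq_zero_left])
  have mul_eq_one {s t : ℝ} {u v : Mink} (h0 : wedge u v ≠ 0)
      (h : wedge (s • u) (t • v) = wedge u v) : s * t = 1 := by
    rw [wedge_smul_left, wedge_smul_right, smul_smul] at h
    exact smul_left_injective ℝ h0 (h.trans (one_smul ℝ _).symm)
  -- Each vector is fixed up to a factor. The three pairwise products of the factors are 1, so the
  -- factors coincide and square to 1.
  have hxy : x * y = 1 := mul_eq_one (wedge_ne_zero hD) (by rw [← hx, ← hy, hab])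
  have hxz : x * z = 1 := mul_eq_one (wedge_ne_zero (by rwa [p₁, neg_ne_zero]))
    (by rw [← hx, ← hz, hac])
  have hyz : y * z = 1 := mul_eq_one (wedge_ne_zero (by rwa [p₂])) (by rw [← hy, ← hz, hbc])
  have hyx : y = x := by linear_combination -y * hxz + x * hyz
  have hzx : z = x := by linear_combination -z * hxy + x * hyz
  subst hyx hzx
  exact ⟨_, hxy, hx, hy, hz⟩

theorem eq_of_smul_eq_smul_of_det4_ne_zero {a b c d : Mink} {s t : ℝ} (hD : det4 a b c d ≠ 0)
    (h : s • a = t • a) : s = t := by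
  have h1 := congrArg (fun u => wedge u b) h
  simp only [wedge_smul_left] at h1
  exact smul_left_injective ℝ (wedge_ne_zero hD) h1

/-- If the bivectors in each corner cell come from four vectors, then the bivectors of the whole
4-simplex come from five vectors. -/
theorem exists_wedge_of_cells {B : Fin 5 → Fin 5 → so31} (hB : ∀ P Q, B Q P = -B P Q)
    (h : ∀ P : Fin 5, ∃ e : Fin 4 → Mink, det4 (e 0) (e 1) (e 2) (e 3) ≠ 0 ∧
      ∀ i j, B (P.succAbove i) (P.succAbove j) = hodge (wedge (e i) (e j))) :
    ∃ e : Fin 5 → Mink, ∀ P Q, B P Q = hodge (wedge (e P) (e Q)) := by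
  obtain ⟨f, hf, hfB⟩ := h 4
  obtain ⟨g, hg, hgB⟩ := h 3
  obtain ⟨k, hk, hkB⟩ := h 0
  obtain ⟨s, hs, hs0, hs1, hs2⟩ : ∃ s : ℝ, s * s = 1 ∧ g 0 = s • f 0 ∧ g 1 = s • f 1 ∧
      g 2 = s • f 2 :=
    exists_sign hf (hodge_injective ((hgB 0 1).symm.trans (hfB 0 1)))
      (hodge_injective ((hgB 0 2).symm.trans (hfB 0 2)))
      (hodge_injective ((hgB 1 2).symm.trans (hfB 1 2)))
  obtain ⟨t, ht, ht0, ht1, ht2⟩ : ∃ t : ℝ, t * t = 1 ∧ f 1 = t • k 0 ∧ f 2 = t • k 1 ∧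
      f 3 = t • k 2 :=
    exists_sign hk (hodge_injective ((hfB 1 2).symm.trans (hkB 0 1)))
      (hodge_injective ((hfB 1 3).symm.trans (hkB 0 2)))
      (hodge_injective ((hfB 2 3).symm.trans (hkB 1 2)))
  have w (u : Mink) : wedge u (s • g 3) = wedge (s • u) (g 3) := by
    rw [wedge_smul_left, wedge_smul_right]
  have h04 : B 0 4 = hodge (wedge (f 0) (s • g 3)) := by
    rw [w, ← hs0]
    exact hgB 0 3
  have h14 : B 1 4 = hodge (wedge (f 1) (s • g 3)) := by
    rw [w, ← hs1]
    exact hgB 1 3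
  have h24 : B 2 4 = hodge (wedge (f 2) (s • g 3)) := by
    rw [w, ← hs2]
    exact hgB 2 3
  have hk' : det4 (k 0) (k 1) (k 3) (k 2) ≠ 0 := by
    rwa [(det4_permutations (k 0) (k 1) (k 2) (k 3)).2.2.2.2, neg_ne_zero]
  obtain ⟨r, hr, hr0, hr1, hr2⟩ : ∃ r : ℝ, r * r = 1 ∧ f 1 = r • k 0 ∧ f 2 = r • k 1 ∧
      s • g 3 = r • k 3 :=
    exists_sign hk' (hodge_injective ((hfB 1 2).symm.trans (hkB 0 1)))
      (hodge_injective (h14.symm.trans (hkB 0 3)))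
      (hodge_injective (h24.symm.trans (hkB 1 3)))
  -- Both signs compare f 1 with k 0. Their equality makes them cancel in B 3 4.
  obtain rfl : r = t := eq_of_smul_eq_smul_of_det4_ne_zero hk (hr0.symm.trans ht0)
  have h34 : B 3 4 = hodge (wedge (f 3) (s • g 3)) := by
    rw [hr2, ht2, wedge_smul_left, wedge_smul_right, smul_smul, hr, one_smul]
    exact hkB 2 3
  have lt {P Q : Fin 5} (hPQ : P < Q) : B P Q =
      hodge (wedge ((![f 0, f 1, f 2, f 3, s • g 3] : Fin 5 → Mink) P)
        ((![f 0, f 1, f 2, f 3, s • g 3] : Fin 5 → Mink) Q)) := by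
    fin_cases P <;> fin_cases Q <;>
      first
      | exact absurd hPQ (by decide)
      | exact hfB 0 1
      | exact hfB 0 2
      | exact hfB 0 3
      | exact hfB 1 2
      | exact hfB 1 3
      | exact hfB 2 3
      | exact h04
      | exact h14
      | exact h24
      | exact h34
  refine ⟨![f 0, f 1, f 2, f 3, s • g 3], fun P Q => ?_⟩
  rcases lt_trichotomy P Q with hPQ | rfl | hPQ
  · exact lt hPQ
  · have h1 := hB P P
    rw [eq_neg_iff_add_eq_zero, ← two_smul ℝ] at h1
    rw [wedge_self, hodge_zero]
    exact (smul_eq_zero.1 h1).resolve_left two_ne_zero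
  · rw [hB Q P, wedge_swap, hodge_neg, lt hPQ]

/-! ## The map from tetrad fields to `B` fields -/

theorem BField.ext_comp {B B' : BField X} (h : ∀ ν P Q, B.comp ν P Q = B'.comp ν P Q) : B = B' := by
  cases B with | mk b hb =>
  cases B' with | mk b' hb' =>
  congr 1
  funext ν s
  exact (BField.comp_of_ne _ ν s).symm.trans ((h ν s.1.1 s.1.2).trans (BField.comp_of_ne _ ν s))

theorem ofTetrad_eq_iff_wedge {e e' : Tetrad X} : BField.ofTetrad e = BField.ofTetrad e' ↔
    ∀ ν P Q, wedge (e ν P) (e ν Q) = wedge (e' ν P) (e' ν Q) := by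
  constructor
  · intro h ν P Q
    apply hodge_injective
    rw [← BField.ofTetrad_comp, ← BField.ofTetrad_comp, h]
  · intro h
    refine BField.ext_comp fun ν P Q => ?_
    rw [BField.ofTetrad_comp, BField.ofTetrad_comp, h]

theorem NondegAt.det4_ne_zero {e : Tetrad X} {ν : X.Atom} {P : Fin 5} (h : NondegAt e ν P) :
    det4 (e ν (P.succAbove 0)) (e ν (P.succAbove 1)) (e ν (P.succAbove 2))
      (e ν (P.succAbove 3)) ≠ 0 := by
  have h1 := (nondegAt_iff e ν P).1 h
  have hl : levi (![0, 1, 2, 3] : Fin 4 → Fin 4) = 1 := by decide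
  have h2 := det4_index (fun i => e ν (P.succAbove i)) 0 1 2 3
  rw [hl, Int.cast_one, one_mul] at h2
  rw [h2]
  exact h1

theorem ofTetrad_eq_iff {e e' : Tetrad X} (he : ∀ ν P, NondegAt e ν P) :
    BField.ofTetrad e = BField.ofTetrad e' ↔ ∀ ν, e' ν = e ν ∨ e' ν = -e ν := by
  rw [ofTetrad_eq_iff_wedge]
  constructor
  · intro h ν
    have key {P Q R S : Fin 5} (hD : det4 (e ν P) (e ν Q) (e ν R) (e ν S) ≠ 0) :=
      exists_sign hD (h ν P Q).symm (h ν P R).symm (h ν Q R).symm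
    have d4 : det4 (e ν 0) (e ν 1) (e ν 2) (e ν 3) ≠ 0 := (he ν 4).det4_ne_zero
    have d3 : det4 (e ν 0) (e ν 1) (e ν 2) (e ν 4) ≠ 0 := (he ν 3).det4_ne_zero
    have d4' : det4 (e ν 0) (e ν 1) (e ν 3) (e ν 2) ≠ 0 := by
      rwa [(det4_permutations (e ν 0) (e ν 1) (e ν 2) (e ν 3)).2.2.2.2, neg_ne_zero]
    have d3' : det4 (e ν 0) (e ν 1) (e ν 4) (e ν 2) ≠ 0 := by
      rwa [(det4_permutations (e ν 0) (e ν 1) (e ν 2) (e ν 4)).2.2.2.2, neg_ne_zero]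
    obtain ⟨s, hs, h0, h1, h2⟩ := key d4
    obtain ⟨t, -, ht0, -, h3⟩ := key d4'
    obtain ⟨r, -, hr0, -, h4⟩ := key d3'
    obtain rfl : s = t := eq_of_smul_eq_smul_of_det4_ne_zero d4 (h0.symm.trans ht0)
    obtain rfl : s = r := eq_of_smul_eq_smul_of_det4_ne_zero d4 (h0.symm.trans hr0)
    have hall : e' ν = s • e ν := by
      funext P
      fin_cases P
      exacts [h0, h1, h2, h3, h4]
    rcases mul_self_eq_one_iff.1 hs with rfl | rfl
    · exact .inl (hall.trans (one_smul ℝ _))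
    · exact .inr (hall.trans (neg_one_smul ℝ _))
  · intro h ν P Q
    rcases h ν with h | h
    · rw [h]
    · rw [h, Pi.neg_apply, Pi.neg_apply, ← neg_one_smul ℝ (e ν P), ← neg_one_smul ℝ (e ν Q),
        wedge_smul_left, wedge_smul_right, smul_smul]
      simp

section Image

variable {ι : Type*} [Fintype ι] (T : Module.Basis ι ℝ so31)

theorem ofTetrad_mem_iff (e : Tetrad X) :
    (∀ ν P, GG1 (BField.ofTetrad e) ν P ∧ volume (BField.ofTetrad e) ν P ≠ 0 ∧
      GG3 T (BField.ofTetrad e) ν P) ↔ ∀ ν P, NondegAt e ν P := by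
  refine ⟨fun h ν P => (volume_ofTetrad_ne_zero_iff e ν P).1 (h ν P).2.1, fun h ν P => ?_⟩
  exact ⟨GG1_ofTetrad e ν P, (volume_ofTetrad_ne_zero_iff e ν P).2 (h ν P),
    GG3_ofTetrad T e ν P (h ν P)⟩

theorem exists_ofTetrad_eq {B : BField X}
    (h : ∀ ν P, GG1 B ν P ∧ volume B ν P ≠ 0 ∧ GG3 T B ν P) :
    ∃ e : Tetrad X, BField.ofTetrad e = B := by
  have h1 (ν : X.Atom) : ∃ e : Fin 5 → Mink, ∀ P Q, B.comp ν P Q = hodge (wedge (e P) (e Q)) := by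
    refine exists_wedge_of_cells (fun P Q => B.comp_swap ν P Q) fun P => ?_
    obtain ⟨e, he, heB⟩ := (h ν P).1.exists_cell_eq T (h ν P).2.1 (h ν P).2.2
    refine ⟨e, ?_, heB⟩
    have hl : levi (![0, 1, 2, 3] : Fin 4 → Fin 4) = 1 := by decide
    rwa [det4_index, hl, Int.cast_one, one_mul]
  choose e he using h1
  exact ⟨e, BField.ext_comp fun ν P Q => by rw [BField.ofTetrad_comp, he]⟩

theorem image_nondeg :
    BField.ofTetrad '' {e : Tetrad X | ∀ ν P, NondegAt e ν P} =
      {B : BField X | ∀ ν P, GG1 B ν P ∧ volume B ν P ≠ 0 ∧ GG3 T B ν P} := by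
  ext B
  constructor
  · rintro ⟨e, he, rfl⟩
    exact (ofTetrad_mem_iff T e).2 he
  · intro hB
    obtain ⟨e, rfl⟩ := exists_ofTetrad_eq T hB
    exact ⟨e, (ofTetrad_mem_iff T e).1 hB, rfl⟩

theorem image_nondeg_pos :
    BField.ofTetrad '' {e : Tetrad X | ∀ ν P, NondegAt e ν P ∧ PosAt e ν P} =
      {B : BField X | ∀ ν P, GG1 B ν P ∧ GG2 B ν P ∧ GG3 T B ν P} := by
  ext B
  constructor
  · rintro ⟨e, he, rfl⟩ ν P
    exact ⟨GG1_ofTetrad e ν P, (GG2_ofTetrad_iff e ν P).2 (he ν P).2,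
      GG3_ofTetrad T e ν P (he ν P).1⟩
  · intro hB
    have hB' : ∀ ν P, GG1 B ν P ∧ volume B ν P ≠ 0 ∧ GG3 T B ν P := fun ν P =>
      ⟨(hB ν P).1, (hB ν P).2.1.ne', (hB ν P).2.2⟩
    obtain ⟨e, rfl⟩ := exists_ofTetrad_eq T hB'
    exact ⟨e, fun ν P => ⟨(ofTetrad_mem_iff T e).1 hB' ν P,
      (GG2_ofTetrad_iff e ν P).1 (hB ν P).2.1⟩, rfl⟩

end Image

/-! ## Smooth lifts of curves of `B` fields -/

/-- The triple product that gave the common vector of an isotropic family has rank one. Divided by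
the determinant it gives the components of p ⊗ p; in the variant below it gives those of p ⊗ q. -/
theorem wedge_mul_hodge_mul_wedge (p q r s : Mink) (I N : Fin 4) :
    ((wedge p q).1 * (hodge (wedge p r)).1 * (wedge p s).1) I N =
      -det4 p q r s * (p I * p N * ![-1, 1, 1, 1] N) := by
  simp only [wedge_eq_ofComps, hodge_ofComps, coe_ofComps, det4_eq]
  fin_cases I <;> fin_cases N <;> simp [Matrix.mul_apply, Fin.sum_univ_four] <;> ring

theorem wedge_mul_hodge_mul_wedge' (p q r s : Mink) (I N : Fin 4) :
    ((wedge p q).1 * (hodge (wedge p r)).1 * (wedge q s).1) I N =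
      -det4 p q r s * (p I * q N * ![-1, 1, 1, 1] N) := by
  simp only [wedge_eq_ofComps, hodge_ofComps, coe_ofComps, det4_eq]
  fin_cases I <;> fin_cases N <;> simp [Matrix.mul_apply, Fin.sum_univ_four] <;> ring

/-- The entries of a curve of matrices are smooth at `0`. -/
def SmoothMat (M : ℝ → Matrix (Fin 4) (Fin 4) ℝ) : Prop :=
  ∀ I J, ContDiffAt ℝ ∞ (fun t => M t I J) 0

theorem SmoothMat.mul {M N : ℝ → Matrix (Fin 4) (Fin 4) ℝ} (hM : SmoothMat M) (hN : SmoothMat N) :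
    SmoothMat fun t => M t * N t := by
  intro I J
  simp only [Matrix.mul_apply]
  exact ContDiffAt.sum fun K _ => (hM I K).mul (hN K J)

theorem SmoothMat.bivec {Y : ℝ → so31} (hY : SmoothMat fun t => (Y t).1) :
    SmoothMat fun t => bivec (Y t) :=
  hY.mul fun _ _ => contDiffAt_const

theorem SmoothMat.hodge {Y : ℝ → so31} (hY : SmoothMat fun t => (Y t).1) :
    SmoothMat fun t => (hodge (Y t)).1 := by
  refine SmoothMat.mul (M := fun t => Matrix.of fun I J =>
    (1 / 2 : ℝ) * ∑ K, ∑ L, epsUp I J K L * SimplicialGravity.bivec (Y t) K L)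
    (fun I J => ?_) fun _ _ => contDiffAt_const
  simp only [Matrix.of_apply]
  exact contDiffAt_const.mul (ContDiffAt.sum fun K _ => ContDiffAt.sum fun L _ =>
    contDiffAt_const.mul (hY.bivec K L))

theorem SmoothMat.epsForm {Y Z : ℝ → so31} (hY : SmoothMat fun t => (Y t).1)
    (hZ : SmoothMat fun t => (Z t).1) : ContDiffAt ℝ ∞ (fun t => epsForm (Y t) (Z t)) 0 := by
  change ContDiffAt ℝ ∞ (fun t => ∑ I, ∑ J, ∑ K, ∑ L,
    eps I J K L * SimplicialGravity.bivec (Y t) I J * SimplicialGravity.bivec (Z t) K L) 0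
  exact ContDiffAt.sum fun I _ => ContDiffAt.sum fun J _ => ContDiffAt.sum fun K _ =>
    ContDiffAt.sum fun L _ => (contDiffAt_const.mul (hY.bivec I J)).mul (hZ.bivec K L)

theorem smoothMat_wedge {u v : ℝ → Mink} (hu : ∀ I, ContDiffAt ℝ ∞ (fun t => u t I) 0)
    (hv : ∀ I, ContDiffAt ℝ ∞ (fun t => v t I) 0) : SmoothMat fun t => (wedge (u t) (v t)).1 := by
  intro I J
  simp only [wedge_apply]
  exact (((hu I).mul (hv J)).sub ((hu J).mul (hv I))).mul contDiffAt_const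

theorem smoothMat_comp {B' : ℝ → BField X} {ν : X.Atom}
    (h : ∀ s, SmoothMat fun t => ((B' t).val ν s).1) (P Q : Fin 5) :
    SmoothMat fun t => ((B' t).comp ν P Q).1 := by
  rcases eq_or_ne P Q with rfl | hPQ
  · simp only [BField.comp_self]
    exact fun _ _ => contDiffAt_const
  · simp only [BField.comp, dif_pos hPQ]
    exact h _

theorem levi_ne_zero : ∀ i j k l : Fin 4, i ≠ j → i ≠ k → i ≠ l → j ≠ k → j ≠ l → k ≠ l →
    levi ![i, j, k, l] ≠ 0 := by
  decide

theorem det4_ne_zero_of_nondeg {f : Tetrad X} {ν : X.Atom} (hf : ∀ P, NondegAt f ν P)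
    {a b c d : Fin 5} (hab : a ≠ b) (hac : a ≠ c) (had : a ≠ d) (hbc : b ≠ c) (hbd : b ≠ d)
    (hcd : c ≠ d) : det4 (f ν a) (f ν b) (f ν c) (f ν d) ≠ 0 := by
  obtain ⟨P, ha, hb, hc, hd⟩ : ∃ P, a ≠ P ∧ b ≠ P ∧ c ≠ P ∧ d ≠ P := by
    have : ∀ a b c d : Fin 5, ∃ P, a ≠ P ∧ b ≠ P ∧ c ≠ P ∧ d ≠ P := by decide
    exact this a b c d
  obtain ⟨i, rfl⟩ := Fin.exists_succAbove_eq ha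
  obtain ⟨j, rfl⟩ := Fin.exists_succAbove_eq hb
  obtain ⟨k, rfl⟩ := Fin.exists_succAbove_eq hc
  obtain ⟨l, rfl⟩ := Fin.exists_succAbove_eq hd
  simp only [ne_eq, Fin.succAbove_right_inj] at hab hac had hbc hbd hcd
  rw [det4_index fun i => f ν (P.succAbove i)]
  exact mul_ne_zero (Int.cast_ne_zero.2 (levi_ne_zero i j k l hab hac had hbc hbd hcd))
    ((nondegAt_iff f ν P).1 (hf P))

/-- The products `e_Q^I e_0^N` of components of a nondegenerate tetrad field depend smoothly on the
`B` field. -/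
theorem exists_smooth_products {B' : ℝ → BField X} {e : Tetrad X} {ν : X.Atom}
    (hB : ∀ s, SmoothMat fun t => ((B' t).val ν s).1) (h0 : B' 0 = BField.ofTetrad e)
    (he : ∀ P, NondegAt e ν P) (Q : Fin 5) :
    ∃ G : Fin 4 → Fin 4 → ℝ → ℝ, (∀ I N, ContDiffAt ℝ ∞ (G I N) 0) ∧
      ∀ t f, (∀ P, NondegAt f ν P) → B' t = BField.ofTetrad f →
        ∀ I N, f ν Q I * f ν 0 N = G I N t := by
  obtain ⟨a, b, c, d, hab, hac, had, hbc, hbd, hcd, hQ⟩ : ∃ a b c d : Fin 5, a ≠ b ∧ a ≠ c ∧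
      a ≠ d ∧ b ≠ c ∧ b ≠ d ∧ c ≠ d ∧ (Q = a ∧ (0 = a ∨ 0 = b)) := by
    revert Q
    decide
  obtain ⟨rfl, hQ⟩ := hQ
  have hη (N : Fin 4) : (![-1, 1, 1, 1] : Fin 4 → ℝ) N * ![-1, 1, 1, 1] N = 1 := by
    fin_cases N <;> simp
  have hs := smoothMat_comp hB
  have hD : epsForm ((B' 0).comp ν Q b) ((B' 0).comp ν c d) ≠ 0 := by
    rw [h0, BField.ofTetrad_comp, BField.ofTetrad_comp, epsForm_hodge_hodge, epsForm_wedge_wedge]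
    have := det4_ne_zero_of_nondeg he hab hac had hbc hbd hcd
    simpa using this
  -- The denominator equals 4 det and the triple product has the factor −det, whence −4. The last
  -- vector entry undoes the lowering of N.
  refine ⟨fun I N t => -4 * ((hodge ((B' t).comp ν Q b)).1 * ((B' t).comp ν Q c).1 *
    (hodge ((B' t).comp ν 0 d)).1) I N * ![-1, 1, 1, 1] N /
      epsForm ((B' t).comp ν Q b) ((B' t).comp ν c d), fun I N => ?_, fun t f hf ht I N => ?_⟩
  · exact ((contDiffAt_const.mul ((((hs Q b).hodge).mul (hs Q c)).mul (hs 0 d).hodge I N)).mul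
      contDiffAt_const).div ((hs Q b).epsForm (hs c d)) hD
  · have hdet := det4_ne_zero_of_nondeg hf hab hac had hbc hbd hcd
    have hM : ((hodge ((B' t).comp ν Q b)).1 * ((B' t).comp ν Q c).1 *
        (hodge ((B' t).comp ν 0 d)).1) I N = -det4 (f ν Q) (f ν b) (f ν c) (f ν d) *
          (f ν Q I * f ν 0 N * ![-1, 1, 1, 1] N) := by
      rw [ht]
      simp only [BField.ofTetrad_comp, hodge_hodge, NegMemClass.coe_neg, Matrix.neg_mul,
        Matrix.mul_neg, neg_neg]
      rcases hQ with rfl | rfl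
      · exact wedge_mul_hodge_mul_wedge ..
      · exact wedge_mul_hodge_mul_wedge' ..
    beta_reduce
    rw [hM, ht, BField.ofTetrad_comp, BField.ofTetrad_comp, epsForm_hodge_hodge,
      epsForm_wedge_wedge]
    field_simp
    linear_combination (-(f ν Q I * f ν 0 N)) * hη N

/-- A smooth curve of `B` fields of nondegenerate tetrad fields is the image of a smooth curve of
tetrad fields. -/
theorem exists_smooth_lift {B' : ℝ → BField X} {e : Tetrad X}
    (hB : ∀ ν s, SmoothMat fun t => ((B' t).val ν s).1) (h0 : B' 0 = BField.ofTetrad e)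
    (he : ∀ ν P, NondegAt e ν P)
    (hlift : ∀ᶠ t in 𝓝 0, ∃ f, (∀ ν P, NondegAt f ν P) ∧ BField.ofTetrad f = B' t) :
    ∃ e' : ℝ → Tetrad X, e' 0 = e ∧ (∀ ν P I, ContDiffAt ℝ ∞ (fun t => e' t ν P I) 0) ∧
      ∀ᶠ t in 𝓝 0, BField.ofTetrad (e' t) = B' t := by
  choose G hG hGf using fun ν => exists_smooth_products (hB ν) h0 (he ν)
  have hne (ν : X.Atom) : ∃ N, e ν 0 N ≠ 0 := by
    have h1 := wedge_ne_zero (he ν 4).det4_ne_zero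
    by_contra! hc
    have h2 : e ν 0 = (0 : ℝ) • e ν 0 := by
      rw [zero_smul]
      exact funext hc
    apply h1
    change wedge (e ν 0) (e ν 1) = 0
    rw [h2, wedge_smul_left, zero_smul]
  choose N hN using hne
  have hG0 (ν : X.Atom) (Q : Fin 5) (I J : Fin 4) : e ν Q I * e ν 0 J = G ν Q I J 0 :=
    hGf ν Q 0 e (he ν) h0 I J
  have hpos (ν : X.Atom) : 0 < G ν 0 (N ν) (N ν) 0 := by
    rw [← hG0]
    exact mul_self_pos.2 (hN ν)
  -- Divide e_Q^I e_0^N by e_0^N, where e_0^N is recovered as the root of its square with the sign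
  -- that it has at t = 0.
  refine ⟨fun t ν Q I => G ν Q I (N ν) t *
    (e ν 0 (N ν) / |e ν 0 (N ν)| / √(G ν 0 (N ν) (N ν) t)), ?_, fun ν Q I => ?_, ?_⟩
  · funext ν Q I
    beta_reduce
    rw [← hG0, ← hG0, Real.sqrt_mul_self_eq_abs, div_div, abs_mul_abs_self]
    have := hN ν
    field_simp
  · exact (hG ν Q I (N ν)).mul (contDiffAt_const.div ((hG ν 0 (N ν) (N ν)).sqrt (hpos ν).ne')
      (Real.sqrt_pos.2 (hpos ν)).ne')
  · have hev : ∀ᶠ t in 𝓝 0, ∀ ν, 0 < G ν 0 (N ν) (N ν) t :=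
      eventually_all.2 fun ν => (hG ν 0 (N ν) (N ν)).continuousAt.eventually (lt_mem_nhds (hpos ν))
    filter_upwards [hlift, hev] with t ⟨f, hf, hft⟩ ht
    -- The preimage f is chosen separately for each t and need not be continuous. It suffices that
    -- it agrees with the constructed curve up to a sign on each 4-simplex.
    rw [← hft, eq_comm, ofTetrad_eq_iff hf]
    intro ν
    have h1 (Q : Fin 5) (I : Fin 4) : f ν Q I * f ν 0 (N ν) = G ν Q I (N ν) t :=
      hGf ν Q t f (hf ν) hft.symm I (N ν)
    have h2 : f ν 0 (N ν) ≠ 0 := by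
      intro h
      have h3 := ht ν
      rw [← h1, h, mul_zero] at h3
      exact lt_irrefl _ h3
    have h3 := hN ν
    rcases h3.lt_or_gt with h3 | h3 <;> rcases h2.lt_or_gt with h2 | h2
    · refine .inl (funext fun Q => funext fun I => ?_)
      rw [← h1, ← h1, Real.sqrt_mul_self_eq_abs, abs_of_neg h3, abs_of_neg h2]
      field_simp
    · refine .inr (funext fun Q => funext fun I => ?_)
      rw [← h1, ← h1, Real.sqrt_mul_self_eq_abs, abs_of_neg h3, abs_of_pos h2, Pi.neg_apply,
        Pi.neg_apply]
      field_simp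
    · refine .inr (funext fun Q => funext fun I => ?_)
      rw [← h1, ← h1, Real.sqrt_mul_self_eq_abs, abs_of_pos h3, abs_of_neg h2, Pi.neg_apply,
        Pi.neg_apply]
      field_simp
    · refine .inl (funext fun Q => funext fun I => ?_)
      rw [← h1, ← h1, Real.sqrt_mul_self_eq_abs, abs_of_pos h3, abs_of_pos h2]
      field_simp

/-! ## Equivalence of the models -/

theorem smoothMat_ofTetrad {e' : ℝ → Tetrad X}
    (he : ∀ ν P I, ContDiffAt ℝ ∞ (fun t => e' t ν P I) 0) (ν : X.Atom) (s : OWedge) :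
    SmoothMat fun t => ((BField.ofTetrad (e' t)).val ν s).1 :=
  (smoothMat_wedge (he ν s.1.1) (he ν s.1.2)).hodge

/-- The `e`-model in a sector of nondegenerate tetrad fields that is closed under changes of sign
of the tetrad is equivalent to the `B`-model constrained to the image of the sector. -/
theorem modelsEquivalent_of_image [DecidableEq V] {ι : Type*} [Fintype ι] [DecidableEq ι]
    (T : Module.Basis ι ℝ so31) (γ : OnePoint ℝ) {E : Set (Tetrad X)} {C : Set (BField X)}
    (hE : ∀ e ∈ E, ∀ ν P, NondegAt e ν P) (himage : BField.ofTetrad '' E = C)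
    (hclosed : ∀ e, BField.ofTetrad e ∈ C → e ∈ E) : ModelsEquivalent T γ E C where
  image := himage
  unique e he e' _ := ofTetrad_eq_iff (hE e he)
  action e _ h k := actionB_ofTetrad T γ e h k
  solutions e he h k := by
    constructor
    · intro hB e' h' k' he0 hsmooth hmem hconn
      have h1 := hB (fun t => BField.ofTetrad (e' t)) h' k' (congrArg _ he0)
        (smoothMat_ofTetrad hsmooth)
        (hmem.mono fun t ht => himage ▸ Set.mem_image_of_mem _ ht) hconn
      simpa only [actionB_ofTetrad] using h1
    · intro hS B' h' k' hB0 hsmooth hmem hconn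
      obtain ⟨e', he0, he', hlift⟩ := exists_smooth_lift hsmooth hB0 (hE e he)
        (hmem.mono fun t ht => by
          rw [← himage] at ht
          obtain ⟨f, hf, hft⟩ := ht
          exact ⟨f, hE f hf, hft⟩)
      have h1 := hS e' h' k' he0 he'
        -- The lift stays in the sector because membership in E can be read off from the B field.
        (by filter_upwards [hmem, hlift] with t ht htl using hclosed _ (htl ▸ ht)) hconn
      refine h1.congr_of_eventuallyEq ?_
      filter_upwards [hlift] with t ht
      rw [← ht, actionB_ofTetrad]

end SimplicialGravity

end

/-! ### The two equivalences and the meaning of GG2 -/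

theorem mainTheorem5 {V : Type*} [DecidableEq V] (X : SimplicialGravity.OrientedComplex V)
    {ι : Type*} [Fintype ι] [DecidableEq ι] (T : Module.Basis ι ℝ SimplicialGravity.so31)
    (γ : OnePoint ℝ) (hγ : γ ≠ ((0 : ℝ) : OnePoint ℝ)) :
    SimplicialGravity.ModelsEquivalent T γ
      {e : SimplicialGravity.Tetrad X | ∀ ν P,
        SimplicialGravity.NondegAt e ν P ∧ SimplicialGravity.PosAt e ν P}
      {B : SimplicialGravity.BField X | ∀ ν P, SimplicialGravity.GG1 B ν P ∧
        SimplicialGravity.GG2 B ν P ∧ SimplicialGravity.GG3 T B ν P} ∧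
    SimplicialGravity.ModelsEquivalent T γ
      {e : SimplicialGravity.Tetrad X | ∀ ν P, SimplicialGravity.NondegAt e ν P}
      {B : SimplicialGravity.BField X | ∀ ν P, SimplicialGravity.GG1 B ν P ∧
        SimplicialGravity.volume B ν P ≠ 0 ∧ SimplicialGravity.GG3 T B ν P} ∧
    (∀ e : SimplicialGravity.Tetrad X, (∀ ν P, SimplicialGravity.NondegAt e ν P) → ∀ ν P,
      (SimplicialGravity.GG2 (SimplicialGravity.BField.ofTetrad e) ν P ↔
        SimplicialGravity.PosAt e ν P)) := by
  refine ⟨SimplicialGravity.modelsEquivalent_of_image T γ (fun e he ν P => (he ν P).1)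
      (SimplicialGravity.image_nondeg_pos T) fun e he ν P => ?_,
    SimplicialGravity.modelsEquivalent_of_image T γ (fun e he => he)
      (SimplicialGravity.image_nondeg T) fun e => (SimplicialGravity.ofTetrad_mem_iff T e).1,
    fun e _ => SimplicialGravity.GG2_ofTetrad_iff e⟩
  -- A positive volume yields both nondegeneracy and positive orientation, so the positive sector
  -- contains every tetrad field whose B field satisfies the constraints.
  have hGG2 := (he ν P).2.1
  exact ⟨(SimplicialGravity.volume_ofTetrad_ne_zero_iff e ν P).1 hGG2.ne',
    (SimplicialGravity.GG2_ofTetrad_iff e ν P).1 hGG2⟩
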